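/- Let $k,d\ge 1$ be integers and $g,J_0>0$, $\eta>2$ real numbers. Consider a chain $\Lambda=\{1,\dots,n\}$ ($n\ge 1$) of $d$-dimensional qudits with a Hamiltonian $H=\sum_{Z\subseteq\Lambda,\,|Z|\le k}h_Z$, where each $h_Z$ is Hermitian and acts only on the sites of $Z$, and $$\max_{i}\sum_{Z\ni i}\|h_Z\|\le g,\qquad \sum_{Z\ni i,i'}\|h_Z\|\le J_0\,|i-i'|^{-\eta}\quad (i\neq i').$$ For $\beta>0$ let $Z_\beta=\mathrm{tr}\,e^{-\beta H}$ and let $$|\rho_\beta\rangle=\frac1{\sqrt{Z_\beta}}\,\bigl(e^{-\beta H/2}\otimes \hat 1_{\Lambda'}\bigr)\sum_{j=1}^{d^n}|j_\Lambda\rangle\otimes|j_{\Lambda'}\rangle$$ be the purified Gibbs state, where $\Lambda'$ is a copy of $\Lambda$, $\{|j_\Lambda\rangle\}$ is an arbitrary orthonormal basis on $\Lambda$, and $\{|j_{\Lambda'}\rangle\}$ is its copy on $\Lambda'$ under a site-by-site identification (that is, its image under a product of one-site antiunitary maps; e.g. both are product bases with arbitrary one-site orthonormal bases). Regard $|\rho_\beta\rangle$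 as a state of $n$ sites, the $i$-th site consisting of the $i$-th qudits of $\Lambda$ and $\Lambda'$. A matrix product state (MPS) of bond dimension $D$ is a vector $\sum_{s_1,\dots,s_n}\mathrm{tr}\bigl(M_1^{[s_1]}\cdots M_n^{[s_n]}\bigr)|s_1,\dots,s_n\rangle$ with $D\times D$ complex matrices $M_i^{[s]}$. Put $$\mathcal Q_0=\Bigl[\min\Bigl(\frac1{8gk},\frac{\eta-2}{16e J_0(\eta-1)^2 2^{\eta-2}}\Bigr)\Bigr]^{-1},\qquad \kappa_\beta=4\Bigl[6+\frac{4(k+1)}{\eta-2}+2k\log_2 d\Bigr]\Bigl\lceil\frac{\beta\mathcal Q_0}{4}\Bigr\rceil .$$ (i) For every $n\ge1$, every such $H$ and bases, every $\beta>0$ and every integer $D\ge 1$ there is an MPS $|\mathrm M_\beta(D)\rangle$ of bond dimension $D$ with $$\bigl\|\,|\rho_\beta\rangle-|\mathrm M_\beta(D)\rangle\bigr\|\le 960\,n\,\lceil\beta\mathcal Q_0/4\rceil\,D^{-1/\kappa_\beta}.$$ (ii) Consequently a polynomial bond dimension with exponent linear in $\beta$ suffices: there is a constant $C>0$ depending only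 on $k,d,g,J_0,\eta$ such that for all $n\ge1$, all such $H$ and bases, all $\beta>0$ and all $0<\varepsilon\le1$, some MPS of bond dimension $D\le\bigl((2+\beta)\,n/\varepsilon\bigr)^{C(1+\beta)}$ satisfies $\bigl\|\,|\rho_\beta\rangle-|\mathrm M\rangle\bigr\|\le\varepsilon$. (In particular, $D=(n/\varepsilon)^{O(\beta)}$ when $\beta$ is bounded away from $0$ and $n/\varepsilon\ge 2+\beta$.) -/

import Mathlib

noncomputable section

namespace LongRangeGibbs

/-- Basis configurations of a chain of `n` qudits of local dimension `d`;
the sites are the elements of `Fin n`. -/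
abbrev Config (n d : ℕ) : Type := Fin n → Fin d

/-- Operators on the Hilbert space of the chain, as matrices in the computational basis. -/
abbrev Op (n d : ℕ) : Type := Matrix (Config n d) (Config n d) ℂ

/-- The Hilbert space of the chain. -/
abbrev ChainSpace (n d : ℕ) : Type := EuclideanSpace ℂ (Config n d)

/-- The operator norm (largest singular value). -/
def opNorm {n d : ℕ} (A : Op n d) : ℝ := ‖Matrix.toEuclideanCLM (𝕜 := ℂ) A‖

/-- `A` acts only on the sites of `Z`: it is `a ⊗ 1` for an operator `a` on the qudits in `Z`. -/
def SupportedOn {n d : ℕ} (Z : Finset (Fin n)) (A : Op n d) : Prop :=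
  ∃ a : Matrix (Z → Fin d) (Z → Fin d) ℂ, ∀ s t : Config n d,
    A s t = if ∀ i, i ∉ Z → s i = t i then a (fun i => s i) (fun i => t i) else 0

/-- The family `h Z` of interaction terms is `k`-local, has one-site energy at most `g`, and
decays as the power law `J₀ r ^ (-η)`. -/
structure IsPowerLawInteraction {n d : ℕ} (k : ℕ) (g J₀ η : ℝ)
    (h : Finset (Fin n) → Op n d) : Prop where
  isHermitian : ∀ Z, (h Z).IsHermitian
  supportedOn : ∀ Z, SupportedOn Z (h Z)
  local_terms : ∀ Z, k < Z.card → h Z = 0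
  site_energy : ∀ i : Fin n, ∑ Z with i ∈ Z, opNorm (h Z) ≤ g
  decay : ∀ i j : Fin n, i ≠ j →
    ∑ Z with i ∈ Z ∧ j ∈ Z, opNorm (h Z) ≤ J₀ * |((i : ℕ) : ℝ) - ((j : ℕ) : ℝ)| ^ (-η)

/-- The Hamiltonian `H = ∑ h_Z`. -/
def hamiltonian {n d : ℕ} (h : Finset (Fin n) → Op n d) : Op n d := ∑ Z, h Z

/-- The partition function `Z_β = tr e^{-βH}` (a real number, as `H` is Hermitian). -/
def partitionFunction {n d : ℕ} (H : Op n d) (β : ℝ) : ℝ :=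
  (Matrix.trace (NormedSpace.exp ((-(β : ℂ)) • H))).re

/-- `e'` is the copy of the basis `e` under a site-by-site identification of the chain `Λ` with
its copy `Λ'`: `e' j` is the image of `e j` under complex conjugation followed by a product of
one-site unitaries, i.e. under a product of one-site antiunitaries. -/
def IsLocalCopy {n d : ℕ}
    (e e' : OrthonormalBasis (Config n d) ℂ (ChainSpace n d)) : Prop :=
  ∃ W : Fin n → Matrix.unitaryGroup (Fin d) ℂ, ∀ (j t : Config n d),
    e' j t = ∑ s : Config n d,
      (∏ i, (W i : Matrix (Fin d) (Fin d) ℂ) (t i) (s i)) * star (e j s)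

/-- The purified Gibbs state `Z_β^{-1/2} (e^{-βH/2} ⊗ 1) ∑_j |e j⟩ ⊗ |e' j⟩`, as a vector of the
doubled chain, whose site `i` consists of the `i`-th qudit of `Λ` and the `i`-th qudit of `Λ'`. -/
def purifiedGibbs {n d : ℕ} (H : Op n d) (β : ℝ)
    (e e' : OrthonormalBasis (Config n d) ℂ (ChainSpace n d)) :
    EuclideanSpace ℂ (Fin n → Fin d × Fin d) :=
  WithLp.toLp 2 fun σ =>
    ((Real.sqrt (partitionFunction H β) : ℝ) : ℂ)⁻¹ *
      ∑ j : Config n d,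
        (NormedSpace.exp ((-(β / 2 : ℂ)) • H)).mulVec (fun s => e j s) (fun i => (σ i).1) *
          e' j (fun i => (σ i).2)

/-- The matrix product state with bond dimension `D`, local basis `P`, and matrices `M i p`:
its amplitude at `σ` is `tr (M 1 (σ 1) ⋯ M n (σ n))`. -/
def mps {n D : ℕ} {P : Type} [Fintype P] (M : Fin n → P → Matrix (Fin D) (Fin D) ℂ) :
    EuclideanSpace ℂ (Fin n → P) :=
  WithLp.toLp 2 fun σ => Matrix.trace (List.ofFn fun i => M i (σ i)).prod

/-- The constant `𝒬₀`. -/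
def Q0 (k : ℕ) (g J₀ η : ℝ) : ℝ :=
  (min (1 / (8 * g * k))
    ((η - 2) / (16 * Real.exp 1 * J₀ * (η - 1) ^ 2 * (2 : ℝ) ^ (η - 2))))⁻¹

/-- The number `⌈β 𝒬₀ / 4⌉`. -/
def steps (k : ℕ) (g J₀ η β : ℝ) : ℕ := ⌈β * Q0 k g J₀ η / 4⌉₊

/-- The exponent `κ_β`. -/
def kappa (k d : ℕ) (g J₀ η β : ℝ) : ℝ :=
  4 * (6 + 4 * ((k : ℝ) + 1) / (η - 2) + 2 * k * Real.logb 2 d) * steps k g J₀ η β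

end LongRangeGibbs

end

noncomputable section

namespace LongRangeGibbs

open Finset

/-! High temperature, one cut. Write H = H₀ + V, where V collects the terms crossing the cut. The
propagator Φ = e^{-H} e^{H₀} has a Dyson series whose letters are the Taylor coefficients of
e^{-tH₀} V_r e^{tH₀}, with V_r the crossing terms of range r. The m-th coefficient of a letter is
given weight about ((η-2)/2) log₂ r + m, and only words of total weight at most W are kept. Since η
> 2, the letters remain summable after multiplication by 2^weight, so the truncation error is
O(2^{-W}). The number of product terms V_r needs across the cut is polynomial in r, hence
exponential in its weight, so the truncated series has Schmidt rank exponential in W. Multiplication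
by e^{-H₀}, a product across the cut, leaves the rank unchanged. As Φ⁻¹ is bounded, the result is (1
+ E) e^{-H} with ‖E‖ = O(2^{-W}): a relative error, independent of n (`exists_mul_exp_eq`,
`schmidtLE_truncSum`, `exists_schmidtLE_one_add_mul_exp`).

Low temperature. Write e^{-βH/2} = X^{2q} with X = e^{-tH} at high temperature and q proportional to
β. The power ((1 + E) X)^{2q} has the 2q-th power of the rank, and a Hölder-type inequality
(`frob_word_le`) bounds its Hilbert-Schmidt distance from X^{2q} by ((1 + ‖E‖)^{2q} - 1) ‖X^{2q}‖₂.
The squared norm of X^{2q} is the partition function, so this is exactly the error of the purified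
state.

All cuts. The approximants at different cuts are unrelated, but successive projection onto their
column spaces gives one MPS whose error is at most the sum of the errors at the cuts
(`exists_train_frob_le`). Choosing W by 2^W ≈ D^{1/κ} gives (i), and solving the bound for D gives
(ii). -/

/-- The Leibniz rule for coefficients of a product of power series: the factor N + 1 = p.1 + p.2 is
shared between the two factors. -/
theorem sum_antidiagonal_succ_weight {E : Type*} [AddCommGroup E] [Module ℂ E]
    (f : ℕ → ℕ → E) (N : ℕ) :
    ((N : ℂ) + 1) • ∑ p ∈ antidiagonal (N + 1), f p.1 p.2 =
      ∑ p ∈ antidiagonal N, (((p.1 : ℂ) + 1) • f (p.1 + 1) p.2 +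
        ((p.2 : ℂ) + 1) • f p.1 (p.2 + 1)) := by
  have h1 : ((N : ℂ) + 1) • ∑ p ∈ antidiagonal (N + 1), f p.1 p.2 =
      ∑ p ∈ antidiagonal (N + 1), ((p.1 : ℂ) • f p.1 p.2) +
        ∑ p ∈ antidiagonal (N + 1), ((p.2 : ℂ) • f p.1 p.2) := by
    rw [← sum_add_distrib, smul_sum]
    refine sum_congr rfl fun p hp => ?_
    rw [← add_smul]
    congr 1
    rw [HasAntidiagonal.mem_antidiagonal] at hp
    exact_mod_cast hp.symm
  rw [h1, Nat.sum_antidiagonal_succ, Nat.sum_antidiagonal_succ', sum_add_distrib]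
  simp

/-! ### Formal Dyson series of the interaction picture -/

section Algebraic

variable {𝒜 : Type*} [Ring 𝒜] [Algebra ℂ 𝒜]

/-- The Taylor coefficients of `e^{-tH} V e^{tH}`. -/
def adCoeff (H V : 𝒜) : ℕ → 𝒜
  | 0 => V
  | m + 1 => -(((m : ℂ) + 1)⁻¹ • (H * adCoeff H V m - adCoeff H V m * H))

theorem adCoeff_succ_smul (H V : 𝒜) (m : ℕ) :
    ((m : ℂ) + 1) • adCoeff H V (m + 1) = adCoeff H V m * H - H * adCoeff H V m := by
  have : (m : ℂ) + 1 ≠ 0 := by exact_mod_cast Nat.succ_ne_zero m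
  rw [adCoeff, smul_neg, smul_smul, mul_inv_cancel₀ this, one_smul, neg_sub]

theorem adCoeff_sum {ι : Type*} (s : Finset ι) (H : 𝒜) (V : ι → 𝒜) (m : ℕ) :
    adCoeff H (∑ i ∈ s, V i) m = ∑ i ∈ s, adCoeff H (V i) m := by
  induction m with
  | zero => rfl
  | succ m ih =>
    simp only [adCoeff, ih, mul_sum, sum_mul, ← sum_sub_distrib, smul_sum, ← sum_neg_distrib]

/-- The `a`-th term of the exponential series. -/
def expTerm (A : 𝒜) (a : ℕ) : 𝒜 := ((a.factorial : ℂ)⁻¹) • A ^ a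

theorem expTerm_succ_smul (A : 𝒜) (a : ℕ) :
    ((a : ℂ) + 1) • expTerm A (a + 1) = A * expTerm A a := by
  have : (a : ℂ) + 1 ≠ 0 := by exact_mod_cast Nat.succ_ne_zero a
  rw [expTerm, expTerm, smul_smul, mul_smul_comm, pow_succ', Nat.factorial_succ]
  congr 1
  push_cast
  field_simp

theorem mul_expTerm_comm (A : 𝒜) (a : ℕ) : expTerm A a * A = A * expTerm A a := by
  rw [expTerm, smul_mul_assoc, mul_smul_comm, pow_mul_comm']

/-- Degree b of V e^{tH} = e^{tH} (e^{-tH} V e^{tH}). -/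
theorem mul_expTerm (H V : 𝒜) (b : ℕ) :
    V * expTerm H b = ∑ p ∈ antidiagonal b, expTerm H p.1 * adCoeff H V p.2 := by
  induction b with
  | zero => simp [expTerm, adCoeff]
  | succ b ih =>
    have hb : (b : ℂ) + 1 ≠ 0 := by exact_mod_cast Nat.succ_ne_zero b
    have key : ((b : ℂ) + 1) • (V * expTerm H (b + 1)) =
        ((b : ℂ) + 1) • ∑ p ∈ antidiagonal (b + 1), expTerm H p.1 * adCoeff H V p.2 := by
      rw [sum_antidiagonal_succ_weight (fun a m => expTerm H a * adCoeff H V m),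
        ← mul_smul_comm, expTerm_succ_smul, ← mul_expTerm_comm, ← mul_assoc, ih, sum_mul]
      refine sum_congr rfl fun p _ => ?_
      rw [← smul_mul_assoc, expTerm_succ_smul, ← mul_smul_comm, adCoeff_succ_smul,
        ← mul_expTerm_comm]
      noncomm_ring
    have := congrArg (fun x => ((b : ℂ) + 1)⁻¹ • x) key
    simpa only [smul_smul, inv_mul_cancel₀ hb, one_smul] using this

/-- The Taylor coefficients of `e^{-tH} e^{tH₀}`. -/
def expProdCoeff (K H₀ : 𝒜) (N : ℕ) : 𝒜 :=
  ∑ p ∈ antidiagonal N, expTerm K p.1 * expTerm H₀ p.2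

/-- Degree N of the equation Φ' = -Φ V(t) for Φ(t) = e^{-t(H₀+V)} e^{tH₀} and V(t) = e^{-tH₀} V
e^{tH₀}. -/
theorem expProdCoeff_succ (H₀ V : 𝒜) (N : ℕ) :
    ((N : ℂ) + 1) • expProdCoeff (-(H₀ + V)) H₀ (N + 1) =
      -∑ m : Fin (N + 1), expProdCoeff (-(H₀ + V)) H₀ (N - m) * adCoeff H₀ V m := by
  set K := -(H₀ + V) with hK
  have h1 : ((N : ℂ) + 1) • expProdCoeff K H₀ (N + 1) =
      -∑ p ∈ antidiagonal N, expTerm K p.1 * (V * expTerm H₀ p.2) := by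
    rw [expProdCoeff, sum_antidiagonal_succ_weight (fun a m => expTerm K a * expTerm H₀ m),
      ← sum_neg_distrib]
    refine sum_congr rfl fun p _ => ?_
    rw [← smul_mul_assoc, expTerm_succ_smul, ← mul_smul_comm, expTerm_succ_smul,
      ← mul_expTerm_comm, hK]
    noncomm_ring
  rw [h1]
  congr 1
  have h2 : ∀ m : Fin (N + 1), expProdCoeff K H₀ (N - m) * adCoeff H₀ V m =
      (fun q : ℕ × ℕ => expProdCoeff K H₀ q.2 * adCoeff H₀ V q.1) ((m : ℕ), N - m) :=
    fun m => rfl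
  rw [sum_congr rfl (fun m _ => h2 m), Fin.sum_univ_eq_sum_range
    (fun m => (fun q : ℕ × ℕ => expProdCoeff K H₀ q.2 * adCoeff H₀ V q.1) (m, N - m)),
    ← Nat.sum_antidiagonal_eq_sum_range_succ_mk
      (fun q : ℕ × ℕ => expProdCoeff K H₀ q.2 * adCoeff H₀ V q.1)]
  simp only [mul_expTerm H₀ V, mul_sum, expProdCoeff, sum_mul]
  rw [sum_sigma', sum_sigma']
  -- Both sides are now sums over triples of degrees adding up to N; the bijection regroups them.
  refine sum_nbij' (fun x => ⟨(x.2.2, x.1.1 + x.2.1), (x.1.1, x.2.1)⟩)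
    (fun x => ⟨(x.2.1, x.2.2 + x.1.1), (x.2.2, x.1.1)⟩) ?_ ?_ ?_ ?_ ?_
  · rintro ⟨⟨a, b⟩, ⟨c, e⟩⟩ h
    simp only [mem_sigma, HasAntidiagonal.mem_antidiagonal, and_true] at h ⊢
    omega
  · rintro ⟨⟨a, b⟩, ⟨c, e⟩⟩ h
    simp only [mem_sigma, HasAntidiagonal.mem_antidiagonal, and_true] at h ⊢
    omega
  · rintro ⟨⟨a, b⟩, ⟨c, e⟩⟩ h
    simp only [mem_sigma, HasAntidiagonal.mem_antidiagonal] at h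
    obtain ⟨h1, rfl⟩ := h
    rfl
  · rintro ⟨⟨a, b⟩, ⟨c, e⟩⟩ h
    simp only [mem_sigma, HasAntidiagonal.mem_antidiagonal] at h
    obtain ⟨h1, rfl⟩ := h
    rfl
  · rintro ⟨⟨a, b⟩, ⟨c, e⟩⟩ h
    simp only [mul_assoc]

/-- Coefficients of the perturbative expansion with letters `v r m`. -/
def dysonCoeff {ι : Type*} [Fintype ι] (v : ι → ℕ → 𝒜) : ℕ → 𝒜
  | 0 => 1
  | N + 1 => -(((N : ℂ) + 1)⁻¹ • ∑ m : Fin (N + 1), ∑ r, dysonCoeff v (N - m) * v r m)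

/-- The part of `dysonCoeff` formed by the words of total weight at most `W`, where the letter
`v r m` has weight `w r + m`. -/
def truncCoeff {ι : Type*} [Fintype ι] (w : ι → ℕ) (v : ι → ℕ → 𝒜) : ℕ → ℕ → 𝒜
  | 0, _ => 1
  | N + 1, W => -(((N : ℂ) + 1)⁻¹ • ∑ m : Fin (N + 1), ∑ r,
      if w r + m ≤ W then truncCoeff w v (N - m) (W - (w r + m)) * v r m else 0)

/-- Both sequences start at 1 and obey the same recursion, `adCoeff` being additive in V. -/
theorem dysonCoeff_eq {ι : Type*} [Fintype ι] (H₀ : 𝒜) (V : ι → 𝒜) (N : ℕ) :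
    dysonCoeff (fun r m => adCoeff H₀ (V r) m) N =
      expProdCoeff (-(H₀ + ∑ r, V r)) H₀ N := by
  induction N using Nat.strong_induction_on with
  | _ N ih =>
    cases N with
    | zero => simp [dysonCoeff, expProdCoeff, expTerm]
    | succ N =>
      have hN : (N : ℂ) + 1 ≠ 0 := by exact_mod_cast Nat.succ_ne_zero N
      have h := congrArg (fun x => ((N : ℂ) + 1)⁻¹ • x) (expProdCoeff_succ H₀ (∑ r, V r) N)
      simp only [smul_smul, inv_mul_cancel₀ hN, one_smul] at h
      rw [h, dysonCoeff, smul_neg]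
      congr 2
      refine sum_congr rfl fun m _ => ?_
      rw [← mul_sum, ih (N - m) (by omega), adCoeff_sum]

end Algebraic

/-! ### Norm bounds for the series and for its truncation by weight -/

section Normed

variable {𝒜 : Type*} [NormedRing 𝒜] [NormedAlgebra ℂ 𝒜] [NormOneClass 𝒜]
variable {ι : Type*} [Fintype ι] {w : ι → ℕ} {v : ι → ℕ → 𝒜}

omit [NormOneClass 𝒜] in
-- The prefactor 1/(N+1) averages over the N+1 choices of m, so the recursion loses nothing by
-- summing over them.
theorem norm_inv_smul_sum_le {N : ℕ} {x : Fin (N + 1) → 𝒜} {B : ℝ} (h : ∀ m, ‖x m‖ ≤ B) :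
    ‖-(((N : ℂ) + 1)⁻¹ • ∑ m, x m)‖ ≤ B := by
  have h1 : ‖∑ m, x m‖ ≤ ((N : ℝ) + 1) * B := by
    refine (norm_sum_le_of_le _ fun m _ => h m).trans ?_
    simp
  have h2 : ‖((N : ℂ) + 1)⁻¹‖ = ((N : ℝ) + 1)⁻¹ := by
    rw [norm_inv]
    congr 1
    exact_mod_cast Complex.norm_natCast (N + 1)
  rw [norm_neg, norm_smul, h2, inv_mul_le_iff₀ (by positivity)]
  exact h1

variable (hv : ∀ m, ∑ r, (2 : ℝ) ^ (w r + m) * ‖v r m‖ ≤ (1 / 2) ^ m / 4)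
include hv

/-- The second, sharper bound uses the factor 1/4 in `hv`. It makes the terms of positive order add
up to at most 1/2, which keeps the propagator invertible. -/
theorem norm_dysonCoeff_le_aux (N : ℕ) :
    ‖dysonCoeff v N‖ ≤ (1 / 2) ^ N ∧ ‖dysonCoeff v (N + 1)‖ ≤ (1 / 2) ^ (N + 1) / 2 := by
  induction N using Nat.strong_induction_on with
  | _ N ih =>
    have h0 : ‖dysonCoeff v N‖ ≤ (1 / 2) ^ N := by
      cases N with
      | zero => simp [dysonCoeff]
      | succ N => exact (ih N (by omega)).2.trans (half_le_self (by positivity))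
    refine ⟨h0, ?_⟩
    rw [dysonCoeff]
    refine norm_inv_smul_sum_le fun m => ?_
    have h1 : ‖dysonCoeff v (N - m)‖ ≤ (1 / 2) ^ (N - m : ℕ) := by
      rcases Nat.eq_zero_or_pos (m : ℕ) with h | h
      · rw [h]; exact h0
      · exact (ih (N - m) (by omega)).1
    have h2 : ∑ r, ‖v r m‖ ≤ (1 / 2) ^ (m : ℕ) / 4 := by
      refine (sum_le_sum fun r _ => ?_).trans (hv m)
      exact le_mul_of_one_le_left (norm_nonneg _) (one_le_pow₀ (by norm_num))
    calc ‖∑ r, dysonCoeff v (N - m) * v r m‖ ≤ ∑ r, (1 / 2) ^ (N - m : ℕ) * ‖v r m‖ := by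
          refine norm_sum_le_of_le _ fun r _ => (norm_mul_le _ _).trans ?_
          gcongr
      _ ≤ (1 / 2) ^ (N - m : ℕ) * ((1 / 2) ^ (m : ℕ) / 4) := by
          rw [← mul_sum]; gcongr
      _ = (1 / 2) ^ (N + 1) / 2 := by
          rw [mul_div_assoc', ← pow_add, Nat.sub_add_cancel (by omega), pow_succ]
          ring

theorem norm_dysonCoeff_le (N : ℕ) : ‖dysonCoeff v N‖ ≤ (1 / 2) ^ N :=
  (norm_dysonCoeff_le_aux hv N).1

/-- A letter of weight u carries a factor 2^u in `hv`. If it fits the budget W, induction with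
budget W - u loses exactly 2^u; if not, the whole term is dropped, and 1 ≤ 2^{-W} 2^u. -/
theorem norm_dysonCoeff_sub_truncCoeff_le (N W : ℕ) :
    ‖dysonCoeff v N - truncCoeff w v N W‖ ≤ (1 / 2) ^ W * (1 / 2) ^ N := by
  induction N using Nat.strong_induction_on generalizing W with
  | _ N ih =>
    cases N with
    | zero => simp [dysonCoeff, truncCoeff]
    | succ N =>
      rw [dysonCoeff, truncCoeff, neg_sub_neg, ← smul_sub, ← neg_sub, smul_neg,
        ← sum_sub_distrib]
      refine norm_inv_smul_sum_le fun m => ?_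
      have hm := m.2
      rw [← sum_sub_distrib]
      calc _ ≤ ∑ r, (1 / 2) ^ W * (1 / 2) ^ (N - m : ℕ) * (2 ^ (w r + m) * ‖v r m‖) := by
            refine norm_sum_le_of_le _ fun r _ => ?_
            split_ifs with h
            · rw [← sub_mul]
              refine (norm_mul_le _ _).trans ?_
              rw [← mul_assoc]
              refine mul_le_mul_of_nonneg_right ?_ (norm_nonneg _)
              refine (ih (N - m) (by omega) _).trans (le_of_eq ?_)
              have : (1 / 2 : ℝ) ^ W =
                  (1 / 2) ^ (W - (w r + m)) * (1 / 2) ^ (w r + m) := by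
                rw [← pow_add, Nat.sub_add_cancel h]
              have h2 : (1 / 2 : ℝ) ^ (w r + m : ℕ) * 2 ^ (w r + m : ℕ) = 1 := by
                rw [← mul_pow]; norm_num
              rw [this]
              linear_combination (-(1 / 2 : ℝ) ^ (W - (w r + m)) * (1 / 2) ^ (N - m : ℕ)) * h2
            · rw [sub_zero]
              refine (norm_mul_le _ _).trans ?_
              rw [← mul_assoc]
              refine mul_le_mul_of_nonneg_right ?_ (norm_nonneg _)
              refine (norm_dysonCoeff_le hv (N - m)).trans ?_
              rw [mul_right_comm]
              refine le_mul_of_one_le_left (by positivity) ?_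
              rw [one_div, inv_pow, inv_mul_eq_div, one_le_div (by positivity)]
              exact pow_le_pow_right₀ (by norm_num) (by omega)
        _ ≤ (1 / 2) ^ W * (1 / 2) ^ (N - m : ℕ) * ((1 / 2) ^ (m : ℕ) / 4) := by
            rw [← mul_sum]
            gcongr
            exact hv m
        _ ≤ (1 / 2) ^ W * (1 / 2) ^ (N + 1) := by
            have : (1 / 2 : ℝ) ^ N = (1 / 2) ^ (N - m : ℕ) * (1 / 2) ^ (m : ℕ) := by
              rw [← pow_add, Nat.sub_add_cancel (by omega)]
            rw [pow_succ (1 / 2 : ℝ) N, this]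
            have : 0 ≤ (1 / 2 : ℝ) ^ W * ((1 / 2) ^ (N - m : ℕ) * (1 / 2) ^ (m : ℕ)) := by
              positivity
            nlinarith

end Normed
-- Convergence and the multiplicative form of the error
section ExpSeries

variable {𝒜 : Type*} [NormedRing 𝒜] [NormedAlgebra ℂ 𝒜] [CompleteSpace 𝒜]

theorem hasSum_expTerm (A : 𝒜) : HasSum (expTerm A) (NormedSpace.exp A) := by
  have := NormedSpace.exp_series_hasSum_exp' (𝕂 := ℂ) A
  exact this

omit [CompleteSpace 𝒜] in
theorem summable_norm_expTerm (A : 𝒜) : Summable fun a => ‖expTerm A a‖ :=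
  NormedSpace.norm_expSeries_summable' (𝕂 := ℂ) A

theorem hasSum_expProdCoeff (K H₀ : 𝒜) :
    HasSum (expProdCoeff K H₀) (NormedSpace.exp K * NormedSpace.exp H₀) := by
  have h1 := summable_norm_expTerm K
  have h2 := summable_norm_expTerm H₀
  rw [← (hasSum_expTerm K).tsum_eq, ← (hasSum_expTerm H₀).tsum_eq,
    tsum_mul_tsum_eq_tsum_sum_antidiagonal_of_summable_norm h1 h2]
  exact (summable_norm_sum_mul_antidiagonal_of_summable_norm h1 h2).of_norm.hasSum

variable [NormOneClass 𝒜] {ι : Type*} [Fintype ι]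

/-- The truncated interaction-picture expansion. -/
def truncSum (w : ι → ℕ) (v : ι → ℕ → 𝒜) (W : ℕ) : 𝒜 :=
  ∑ N ∈ range (W + 1), truncCoeff w v N W

/-- With Φ the full propagator and Ψ its inverse, E = (T - Φ) Ψ for the truncation T. Here ‖Ψ‖ ≤ 2
and ‖T - Φ‖ ≤ 3 · 2^{-W}: the words dropped at orders N ≤ W contribute 2 · 2^{-W}, the orders N > W
contribute 2^{-W}. -/
theorem exists_mul_exp_eq {H₀ : 𝒜} {V : ι → 𝒜} {w : ι → ℕ}
    (hv : ∀ m, ∑ r, (2 : ℝ) ^ (w r + m) * ‖adCoeff H₀ (V r) m‖ ≤ (1 / 2) ^ m / 4) (W : ℕ) :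
    ∃ E : 𝒜, ‖E‖ ≤ 6 * (1 / 2) ^ W ∧
      truncSum w (fun r m => adCoeff H₀ (V r) m) W * NormedSpace.exp (-H₀) =
        (1 + E) * NormedSpace.exp (-(H₀ + ∑ r, V r)) := by
  set v : ι → ℕ → 𝒜 := fun r m => adCoeff H₀ (V r) m with hvdef
  set K := H₀ + ∑ r, V r with hK
  set Φ : 𝒜 := NormedSpace.exp (-K) * NormedSpace.exp H₀ with hΦ
  set Ψ : 𝒜 := NormedSpace.exp (-H₀) * NormedSpace.exp K with hΨ
  have hcancel : ∀ A : 𝒜, NormedSpace.exp (-A) * NormedSpace.exp A = 1 := fun A => by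
    let _ : NormedAlgebra ℚ 𝒜 := NormedAlgebra.restrictScalars ℚ ℂ 𝒜
    rw [← NormedSpace.exp_add_of_commute (Commute.refl A).neg_left, neg_add_cancel,
      NormedSpace.exp_zero]
  have hcancel' : ∀ A : 𝒜, NormedSpace.exp A * NormedSpace.exp (-A) = 1 := fun A => by
    simpa using hcancel (-A)
  have hΦΨ : Φ * Ψ = 1 := by
    rw [hΦ, hΨ, mul_assoc, ← mul_assoc (NormedSpace.exp H₀), hcancel', one_mul, hcancel]
  have hsum : HasSum (dysonCoeff v) Φ := by
    have : dysonCoeff v = expProdCoeff (-K) H₀ := funext fun N => dysonCoeff_eq H₀ V N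
    rw [this]
    exact hasSum_expProdCoeff _ _
  have hgeom : HasSum (fun N : ℕ => (1 / 2 : ℝ) ^ N) 2 := hasSum_geometric_two
  -- the inverse of `Φ` is bounded
  have hΨ2 : ‖Ψ‖ ≤ 2 := by
    have h1 : HasSum (fun N => dysonCoeff v (N + 1)) (Φ - 1) := by
      have := (hasSum_nat_add_iff' (f := dysonCoeff v) (g := Φ) 1).2 hsum
      simpa [dysonCoeff] using this
    have h2 : HasSum (fun N : ℕ => (1 / 2 : ℝ) ^ (N + 1) / 2) (1 / 2) := by
      have e : (fun N : ℕ => (1 / 2 : ℝ) ^ (N + 1) / 2) = fun N => (1 / 2) ^ N * (1 / 4) :=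
        funext fun N => by rw [pow_succ]; ring
      have h := hgeom.mul_right (1 / 4)
      rw [show (2 : ℝ) * (1 / 4) = 1 / 2 by norm_num] at h
      rwa [e]
    have h3 : ‖Φ - 1‖ ≤ 1 / 2 := by
      rw [← h1.tsum_eq]
      exact tsum_of_norm_bounded h2 fun N => (norm_dysonCoeff_le_aux hv N).2
    have h4 : Ψ = 1 - (Φ - 1) * Ψ := by rw [sub_mul, hΦΨ, one_mul]; abel
    have h5 : ‖Ψ‖ ≤ 1 + 1 / 2 * ‖Ψ‖ := by
      calc ‖Ψ‖ = ‖1 - (Φ - 1) * Ψ‖ := by rw [← h4]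
        _ ≤ ‖(1 : 𝒜)‖ + ‖(Φ - 1) * Ψ‖ := norm_sub_le _ _
        _ ≤ 1 + 1 / 2 * ‖Ψ‖ := by
          rw [norm_one]
          gcongr
          exact (norm_mul_le _ _).trans (by gcongr)
    linarith
  have herr : ‖truncSum w v W - Φ‖ ≤ 3 * (1 / 2) ^ W := by
    have h1 := hsum.summable.sum_add_tsum_nat_add (W + 1)
    rw [hsum.tsum_eq] at h1
    rw [truncSum, ← h1, ← sub_sub, ← sum_sub_distrib]
    have h2 : ‖∑ N ∈ range (W + 1), (truncCoeff w v N W - dysonCoeff v N)‖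
        ≤ (1 / 2) ^ W * 2 := by
      have h3 : ∀ N ∈ range (W + 1), ‖truncCoeff w v N W - dysonCoeff v N‖ ≤
          (1 / 2 : ℝ) ^ W * (1 / 2) ^ N := fun N _ => by
        rw [norm_sub_rev]
        exact norm_dysonCoeff_sub_truncCoeff_le hv N W
      refine (norm_sum_le_of_le _ h3).trans ?_
      · rw [← mul_sum]
        gcongr
        exact sum_le_hasSum _ (fun _ _ => by positivity) hgeom
    have h3 : ‖∑' N, dysonCoeff v (N + (W + 1))‖ ≤ (1 / 2) ^ W := by
      have : HasSum (fun N : ℕ => (1 / 2 : ℝ) ^ (N + (W + 1))) ((1 / 2) ^ W) := by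
        have e : (1 / 2 : ℝ) ^ W = 2 * (1 / 2) ^ (W + 1) := by rw [pow_succ]; ring
        simp only [pow_add _ _ (W + 1)]
        rw [e]
        exact hgeom.mul_right _
      exact tsum_of_norm_bounded this fun N => norm_dysonCoeff_le hv _
    refine (norm_sub_le _ _).trans ?_
    linarith
  refine ⟨(truncSum w v W - Φ) * Ψ, ?_, ?_⟩
  · calc _ ≤ ‖truncSum w v W - Φ‖ * ‖Ψ‖ := norm_mul_le _ _
      _ ≤ 3 * (1 / 2) ^ W * 2 := by gcongr
      _ = _ := by ring
  · have h6 : 1 + (truncSum w v W - Φ) * Ψ = truncSum w v W * Ψ := by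
      rw [sub_mul, hΦΨ]; abel
    rw [h6, mul_assoc, hΨ, mul_assoc, hcancel', mul_one]

end ExpSeries

/-! ### Schmidt rank relative to two commuting subalgebras -/

section Schmidt

variable {𝒜 : Type*} [Ring 𝒜] [Algebra ℂ 𝒜] {L R : Subalgebra ℂ 𝒜}

/-- `A` is a sum of at most `b` products of an element of `L` and an element of `R`. -/
def SchmidtLE (L R : Subalgebra ℂ 𝒜) (A : 𝒜) (b : ℝ) : Prop :=
  ∃ m : ℕ, (m : ℝ) ≤ b ∧ ∃ l r : Fin m → 𝒜, (∀ i, l i ∈ L) ∧ (∀ i, r i ∈ R) ∧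
    A = ∑ i, l i * r i

theorem SchmidtLE.mono {A : 𝒜} {a b : ℝ} (h : SchmidtLE L R A a) (hab : a ≤ b) :
    SchmidtLE L R A b := by
  obtain ⟨m, hm, h⟩ := h
  exact ⟨m, hm.trans hab, h⟩

theorem SchmidtLE.zero : SchmidtLE L R (0 : 𝒜) 0 :=
  ⟨0, by simp, Fin.elim0, Fin.elim0, fun i => i.elim0, fun i => i.elim0, by simp⟩

theorem SchmidtLE.of_fintype {ι : Type*} [Fintype ι] {l r : ι → 𝒜} (hl : ∀ i, l i ∈ L)
    (hr : ∀ i, r i ∈ R) : SchmidtLE L R (∑ i, l i * r i) (Fintype.card ι) :=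
  ⟨Fintype.card ι, le_rfl, l ∘ (Fintype.equivFin ι).symm, r ∘ (Fintype.equivFin ι).symm,
    fun _ => hl _, fun _ => hr _, (Equiv.sum_comp (Fintype.equivFin ι).symm fun i => l i * r i).symm⟩

theorem SchmidtLE.of_mem {l r : 𝒜} (hl : l ∈ L) (hr : r ∈ R) : SchmidtLE L R (l * r) 1 := by
  simpa using SchmidtLE.of_fintype (ι := Unit) (l := fun _ => l) (r := fun _ => r)
    (fun _ => hl) (fun _ => hr)

theorem SchmidtLE.one : SchmidtLE L R (1 : 𝒜) 1 := by
  simpa using SchmidtLE.of_mem (one_mem L) (one_mem R)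

theorem SchmidtLE.add {A B : 𝒜} {a b : ℝ} (hA : SchmidtLE L R A a) (hB : SchmidtLE L R B b) :
    SchmidtLE L R (A + B) (a + b) := by
  obtain ⟨m, hm, l, r, hl, hr, rfl⟩ := hA
  obtain ⟨m', hm', l', r', hl', hr', rfl⟩ := hB
  have := SchmidtLE.of_fintype (L := L) (R := R) (l := Sum.elim l l') (r := Sum.elim r r')
    (by rintro (i | i) <;> simp [hl, hl']) (by rintro (i | i) <;> simp [hr, hr'])
  rw [Fintype.sum_sum_type] at this
  refine this.mono ?_
  simp only [Fintype.card_sum, Fintype.card_fin, Nat.cast_add]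
  linarith

theorem SchmidtLE.sum {ι : Type*} {s : Finset ι} {A : ι → 𝒜} {a : ι → ℝ}
    (h : ∀ i ∈ s, SchmidtLE L R (A i) (a i)) :
    SchmidtLE L R (∑ i ∈ s, A i) (∑ i ∈ s, a i) := by
  classical
  induction s using Finset.induction_on with
  | empty => simpa using SchmidtLE.zero
  | insert i s hi ih =>
    rw [sum_insert hi, sum_insert hi]
    exact (h i (mem_insert_self _ _)).add (ih fun j hj => h j (mem_insert_of_mem hj))

theorem SchmidtLE.smul {A : 𝒜} {a : ℝ} (c : ℂ) (h : SchmidtLE L R A a) :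
    SchmidtLE L R (c • A) a := by
  obtain ⟨m, hm, l, r, hl, hr, rfl⟩ := h
  refine ⟨m, hm, fun i => c • l i, r, fun i => L.smul_mem (hl i) c, hr, ?_⟩
  simp [smul_sum]

theorem SchmidtLE.neg {A : 𝒜} {a : ℝ} (h : SchmidtLE L R A a) : SchmidtLE L R (-A) a := by
  simpa using h.smul (-1)

theorem SchmidtLE.mul (hLR : ∀ l ∈ L, ∀ r ∈ R, l * r = r * l) {A B : 𝒜} {a b : ℝ}
    (hA : SchmidtLE L R A a) (hB : SchmidtLE L R B b) : SchmidtLE L R (A * B) (a * b) := by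
  obtain ⟨m, hm, l, r, hl, hr, rfl⟩ := hA
  obtain ⟨m', hm', l', r', hl', hr', rfl⟩ := hB
  have := SchmidtLE.of_fintype (L := L) (R := R) (ι := Fin m × Fin m')
    (l := fun p => l p.1 * l' p.2) (r := fun p => r p.1 * r' p.2)
    (fun p => L.mul_mem (hl _) (hl' _)) (fun p => R.mul_mem (hr _) (hr' _))
  rw [Fintype.sum_prod_type] at this
  rw [sum_mul_sum]
  have h2 : ∀ i j, l i * r i * (l' j * r' j) = l i * l' j * (r i * r' j) := fun i j => by
    rw [mul_assoc, ← mul_assoc (r i), ← hLR _ (hl' j) _ (hr i)]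
    simp only [mul_assoc]
  simp only [h2]
  refine this.mono ?_
  simp only [Fintype.card_prod, Fintype.card_fin, Nat.cast_mul]
  exact mul_le_mul hm hm' (Nat.cast_nonneg _) ((Nat.cast_nonneg _).trans hm)

theorem SchmidtLE.pow (hLR : ∀ l ∈ L, ∀ r ∈ R, l * r = r * l) {A : 𝒜} {a : ℝ}
    (hA : SchmidtLE L R A a) (m : ℕ) : SchmidtLE L R (A ^ m) (a ^ m) := by
  induction m with
  | zero => simpa using SchmidtLE.one
  | succ m ih => rw [pow_succ, pow_succ]; exact ih.mul hLR hA

/-- Since `HA` commutes with `R` and `HB` with `L`, the commutator with l r is [HA, l] r + l [HB,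
r]. Each order only doubles the number of products, however complicated `HA` and `HB` are. -/
theorem SchmidtLE.adCoeff (hLR : ∀ l ∈ L, ∀ r ∈ R, l * r = r * l) {HA HB V : 𝒜} {a : ℝ}
    (hA : HA ∈ L) (hB : HB ∈ R) (hV : SchmidtLE L R V a) (m : ℕ) :
    SchmidtLE L R (adCoeff (HA + HB) V m) (2 ^ m * a) := by
  have hcomm : ∀ {A : 𝒜} {a : ℝ}, SchmidtLE L R A a →
      SchmidtLE L R ((HA + HB) * A - A * (HA + HB)) (2 * a) := by
    rintro A a ⟨m, hm, l, r, hl, hr, rfl⟩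
    have h1 : SchmidtLE L R (∑ i, (HA * l i - l i * HA) * r i) a :=
      ⟨m, hm, _, r, fun i => sub_mem (mul_mem hA (hl i)) (mul_mem (hl i) hA), hr, rfl⟩
    have h2 : SchmidtLE L R (∑ i, l i * (HB * r i - r i * HB)) a :=
      ⟨m, hm, l, _, hl, fun i => sub_mem (mul_mem hB (hr i)) (mul_mem (hr i) hB), rfl⟩
    rw [two_mul]
    convert h1.add h2 using 1
    rw [mul_sum, sum_mul, ← sum_sub_distrib, ← sum_add_distrib]
    refine sum_congr rfl fun i _ => ?_
    have e1 : HB * (l i * r i) = l i * (HB * r i) := by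
      rw [← mul_assoc, ← hLR _ (hl i) _ hB, mul_assoc]
    have e2 : l i * r i * HA = l i * HA * r i := by
      rw [mul_assoc, ← hLR _ hA _ (hr i), mul_assoc]
    rw [add_mul, mul_add, e1, e2]
    noncomm_ring
  induction m with
  | zero => simpa [LongRangeGibbs.adCoeff] using hV
  | succ m ih =>
    rw [LongRangeGibbs.adCoeff]
    refine (((hcomm ih).smul _).neg).mono (le_of_eq ?_)
    rw [pow_succ]; ring

variable {ι : Type*} [Fintype ι]

/-- A generating-function count. Weighting the rank of a letter by z^weight gives ρ_r z^{w r}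
(2z)^m, which sums over r and m to at most (1/2) · 2 = 1. Hence words of weight at most W contribute
at most z^{-W}. -/
theorem schmidtLE_truncCoeff (hLR : ∀ l ∈ L, ∀ r ∈ R, l * r = r * l)
    {w : ι → ℕ} {v : ι → ℕ → 𝒜} {ρ : ι → ℝ} {z : ℝ} (hz : 0 < z) (hz1 : z ≤ 1 / 4)
    (hv : ∀ r m, SchmidtLE L R (v r m) (2 ^ m * ρ r)) (hρ : ∀ r, 0 ≤ ρ r)
    (hsum : ∑ r, ρ r * z ^ w r ≤ 1 / 2) (N W : ℕ) :
    SchmidtLE L R (truncCoeff w v N W) (z⁻¹ ^ W) := by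
  have hzi : 1 ≤ z⁻¹ := (one_le_inv₀ hz).2 (hz1.trans (by norm_num))
  induction N using Nat.strong_induction_on generalizing W with
  | _ N ih =>
    cases N with
    | zero =>
      rw [truncCoeff]
      exact SchmidtLE.one.mono (one_le_pow₀ hzi)
    | succ N =>
      rw [truncCoeff]
      refine SchmidtLE.neg (SchmidtLE.smul _ ?_)
      have hterm : ∀ (m : Fin (N + 1)) (r : ι), SchmidtLE L R
          (if w r + m ≤ W then truncCoeff w v (N - m) (W - (w r + m)) * v r m else 0)
          (z⁻¹ ^ W * (1 / 2) ^ (m : ℕ) * (ρ r * z ^ w r)) := by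
        intro m r
        have h0 : 0 ≤ z⁻¹ ^ W * (1 / 2) ^ (m : ℕ) * (ρ r * z ^ w r) := by
          have := hρ r
          positivity
        split_ifs with h
        · refine ((ih (N - m) (by omega) (W - (w r + m))).mul hLR (hv r m)).mono ?_
          have e1 : z⁻¹ ^ W = z⁻¹ ^ (W - (w r + m)) * z⁻¹ ^ (w r + m) := by
            rw [← pow_add, Nat.sub_add_cancel h]
          have e2 : z⁻¹ ^ (w r + m) * z ^ w r = z⁻¹ ^ (m : ℕ) := by
            rw [pow_add, mul_right_comm, ← mul_pow, inv_mul_cancel₀ hz.ne', one_pow, one_mul]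
          have e3 : (2 : ℝ) ^ (m : ℕ) ≤ z⁻¹ ^ (m : ℕ) * (1 / 2) ^ (m : ℕ) := by
            rw [← mul_pow]
            refine pow_le_pow_left₀ (by norm_num) ?_ _
            have : (4 : ℝ) ≤ z⁻¹ := by
              rw [le_inv_comm₀ (by norm_num) hz]
              linarith
            linarith
          calc z⁻¹ ^ (W - (w r + m)) * (2 ^ (m : ℕ) * ρ r)
              ≤ z⁻¹ ^ (W - (w r + m)) * ((z⁻¹ ^ (m : ℕ) * (1 / 2) ^ (m : ℕ)) * ρ r) := by
                have := hρ r
                gcongr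
            _ = _ := by rw [e1, ← e2]; ring
        · exact SchmidtLE.zero.mono h0
      refine (SchmidtLE.sum fun m _ => SchmidtLE.sum fun r _ => hterm m r).mono ?_
      simp only [← mul_sum]
      rw [← sum_mul, ← mul_sum]
      have h2 : ∑ m : Fin (N + 1), (1 / 2 : ℝ) ^ (m : ℕ) ≤ 2 := by
        rw [Fin.sum_univ_eq_sum_range (fun m => (1 / 2 : ℝ) ^ m)]
        exact sum_le_hasSum _ (fun _ _ => by positivity) hasSum_geometric_two
      have h3 : 0 ≤ ∑ r, ρ r * z ^ w r := sum_nonneg fun r _ => mul_nonneg (hρ r) (by positivity)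
      calc _ ≤ z⁻¹ ^ W * 2 * (1 / 2) := by gcongr
        _ = _ := by ring

theorem schmidtLE_truncSum {𝒜 : Type*} [NormedRing 𝒜] [NormedAlgebra ℂ 𝒜]
    {L R : Subalgebra ℂ 𝒜} (hLR : ∀ l ∈ L, ∀ r ∈ R, l * r = r * l)
    {w : ι → ℕ} {v : ι → ℕ → 𝒜} {ρ : ι → ℝ} {z : ℝ} (hz : 0 < z) (hz1 : z ≤ 1 / 4)
    (hv : ∀ r m, SchmidtLE L R (v r m) (2 ^ m * ρ r)) (hρ : ∀ r, 0 ≤ ρ r)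
    (hsum : ∑ r, ρ r * z ^ w r ≤ 1 / 2) (W : ℕ) :
    SchmidtLE L R (truncSum w v W) ((W + 1) * z⁻¹ ^ W) := by
  refine (SchmidtLE.sum fun N _ => schmidtLE_truncCoeff hLR hz hz1 hv hρ hsum N W).mono ?_
  simp

end Schmidt
open scoped Kronecker Matrix.Norms.L2Operator

/-! ### Operators supported on a set of sites -/

section Support

variable {n d : ℕ}

/-- The embedding `a ↦ a ⊗ 1` of the operators on the qudits in `Z`. -/
def suppHom (Z : Finset (Fin n)) :
    Matrix (Z → Fin d) (Z → Fin d) ℂ →ₐ[ℂ] Op n d :=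
  AlgHom.ofLinearMap
    { toFun := fun a => (a ⊗ₖ (1 : Matrix ({i // i ∉ Z} → Fin d) ({i // i ∉ Z} → Fin d) ℂ)).submatrix
        (Equiv.piEquivPiSubtypeProd (fun i => i ∈ Z) fun _ => Fin d)
        (Equiv.piEquivPiSubtypeProd (fun i => i ∈ Z) fun _ => Fin d)
      map_add' := fun a b => by rw [Matrix.add_kronecker]; rfl
      map_smul' := fun c a => by rw [Matrix.smul_kronecker]; rfl }
    (by simp)
    (fun a b => by
      simp only [LinearMap.coe_mk, AddHom.coe_mk]
      rw [Matrix.submatrix_mul_equiv, ← Matrix.mul_kronecker_mul, one_mul])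

theorem suppHom_apply (Z : Finset (Fin n)) (a : Matrix (Z → Fin d) (Z → Fin d) ℂ)
    (s t : Config n d) : suppHom Z a s t =
      if ∀ i, i ∉ Z → s i = t i then a (fun i => s i) (fun i => t i) else 0 := by
  have : suppHom Z a s t = a (fun i => s i) (fun i => t i) *
      (1 : Matrix ({i // i ∉ Z} → Fin d) ({i // i ∉ Z} → Fin d) ℂ)
        (fun i => s i) (fun i => t i) := rfl
  rw [this, Matrix.one_apply]
  by_cases h : ∀ i, i ∉ Z → s i = t i
  · rw [if_pos h, if_pos (funext fun i : {i // i ∉ Z} => h i.1 i.2), mul_one]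
  · rw [if_neg h, if_neg fun h' => h fun i hi => congrFun h' ⟨i, hi⟩, mul_zero]

/-- The algebra of the operators supported on `Z`. -/
def suppAlg (d : ℕ) (Z : Finset (Fin n)) : Subalgebra ℂ (Op n d) := (suppHom Z).range

theorem mem_suppAlg {Z : Finset (Fin n)} {A : Op n d} : A ∈ suppAlg d Z ↔ SupportedOn Z A := by
  constructor
  · rintro ⟨a, rfl⟩
    exact ⟨a, fun s t => suppHom_apply Z a s t⟩
  · rintro ⟨a, ha⟩
    refine ⟨a, ?_⟩
    ext s t
    rw [ha]
    exact suppHom_apply Z a s t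

theorem suppAlg_mono {Z Z' : Finset (Fin n)} (h : Z ⊆ Z') : suppAlg d Z ≤ suppAlg d Z' := by
  intro A hA
  rw [mem_suppAlg] at hA ⊢
  obtain ⟨a, ha⟩ := hA
  refine ⟨fun u v => if ∀ i : Z', (i : Fin n) ∉ Z → u i = v i then
    a (fun i => u ⟨i, h i.2⟩) (fun i => v ⟨i, h i.2⟩) else 0, fun s t => ?_⟩
  rw [ha]
  by_cases h1 : ∀ i, i ∉ Z → s i = t i
  · rw [if_pos h1, if_pos fun i hi => h1 i fun hi' => hi (h hi')]
    symm
    exact if_pos (c := ∀ i : Z', (i : Fin n) ∉ Z → s i = t i) fun i hi => h1 i hi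
  · rw [if_neg h1]
    symm
    by_cases h2 : ∀ i, i ∉ Z' → s i = t i
    · rw [if_pos h2]
      refine if_neg fun h3 => h1 fun i hi => ?_
      by_cases hi' : i ∈ Z'
      · exact h3 ⟨i, hi'⟩ hi
      · exact h2 i hi'
    · exact if_neg h2

theorem suppHom_mul_apply {Z Z' : Finset (Fin n)} (hZ : Disjoint Z Z')
    (a : Matrix (Z → Fin d) (Z → Fin d) ℂ) (b : Matrix (Z' → Fin d) (Z' → Fin d) ℂ)
    (s t : Config n d) : (suppHom Z a * suppHom Z' b) s t =
      if ∀ i, i ∉ Z → i ∉ Z' → s i = t i then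
        a (fun i => s i) (fun i => t i) * b (fun i => s i) (fun i => t i) else 0 := by
  -- The only intermediate configuration with a nonzero contribution: it has already changed to t on
  -- Z and is still s elsewhere.
  set u₀ : Config n d := fun i => if i ∈ Z then t i else s i with hu₀
  rw [Matrix.mul_apply, sum_eq_single u₀]
  · rw [suppHom_apply, suppHom_apply, if_pos fun i hi => by simp [hu₀, hi]]
    have e1 : (fun i : Z => u₀ i) = fun i : Z => t i := funext fun i => by simp [hu₀]
    have e2 : (fun i : Z' => u₀ i) = fun i : Z' => s i := funext fun i => by
      have : (i : Fin n) ∉ Z := fun hi => disjoint_left.1 hZ hi i.2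
      simp [hu₀, this]
    rw [e1, e2]
    by_cases h : ∀ i, i ∉ Z → i ∉ Z' → s i = t i
    · rw [if_pos h, if_pos]
      intro i hi
      by_cases hi' : i ∈ Z
      · simp [hu₀, hi']
      · simp [hu₀, hi', h i hi' hi]
    · rw [if_neg h, if_neg, mul_zero]
      intro h'
      refine h fun i hi hi' => ?_
      have := h' i hi'
      simpa [hu₀, hi] using this
  · intro u _ hu
    rw [suppHom_apply, suppHom_apply]
    by_contra hne
    have h1 : ∀ i, i ∉ Z → s i = u i := by
      by_contra h; rw [if_neg h, zero_mul] at hne; exact hne rfl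
    have h2 : ∀ i, i ∉ Z' → u i = t i := by
      by_contra h; rw [if_neg h, mul_zero] at hne; exact hne rfl
    refine hu (funext fun i => ?_)
    by_cases hi : i ∈ Z
    · simp [hu₀, hi, h2 i (disjoint_left.1 hZ hi)]
    · simp [hu₀, hi, h1 i hi]
  · simp

theorem suppAlg_commute {Z Z' : Finset (Fin n)} (hZ : Disjoint Z Z') :
    ∀ A ∈ suppAlg d Z, ∀ B ∈ suppAlg d Z', A * B = B * A := by
  rintro _ ⟨a, rfl⟩ _ ⟨b, rfl⟩
  ext s t
  refine (suppHom_mul_apply hZ a b s t).trans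
    (Eq.trans ?_ (suppHom_mul_apply hZ.symm b a s t).symm)
  rw [mul_comm (a _ _)]
  congr 1
  exact propext ⟨fun h i hi hi' => h i hi' hi, fun h i hi hi' => h i hi' hi⟩

/-- Expansion in the d^{2|T|} matrix units on T. The size of R plays no role. -/
theorem schmidtLE_of_mem_union {T R : Finset (Fin n)} (hTR : Disjoint T R) {A : Op n d}
    (hA : A ∈ suppAlg d (T ∪ R)) :
    SchmidtLE (suppAlg d T) (suppAlg d R) A ((d : ℝ) ^ (2 * T.card)) := by
  obtain ⟨a, rfl⟩ := hA
  let glue : (T → Fin d) → (R → Fin d) → ((T ∪ R : Finset (Fin n)) → Fin d) := fun u x i =>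
    if h : (i : Fin n) ∈ T then u ⟨i, h⟩ else x ⟨i, (mem_union.1 i.2).resolve_left h⟩
  let b : (T → Fin d) × (T → Fin d) → Matrix (R → Fin d) (R → Fin d) ℂ := fun p =>
    Matrix.of fun x y => a (glue p.1 x) (glue p.2 y)
  have key := SchmidtLE.of_fintype (L := suppAlg d T) (R := suppAlg d R)
    (l := fun p : (T → Fin d) × (T → Fin d) => suppHom T (Matrix.single p.1 p.2 1))
    (r := fun p => suppHom R (b p)) (fun p => ⟨_, rfl⟩) (fun p => ⟨_, rfl⟩)
  have hsum : (∑ p : (T → Fin d) × (T → Fin d),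
      suppHom T (Matrix.single p.1 p.2 1) * suppHom R (b p)) = suppHom (T ∪ R) a := by
    ext s t
    rw [Matrix.sum_apply]
    have e1 : ∀ s : Config n d, glue (fun i : T => s i) (fun i : R => s i) =
        fun i : (T ∪ R : Finset (Fin n)) => s i := fun s => funext fun i => by simp [glue]
    have hterm : ∀ p : (T → Fin d) × (T → Fin d),
        (suppHom T (Matrix.single p.1 p.2 1) * suppHom R (b p)) s t =
          if p = ((fun i : T => s i), (fun i : T => t i)) then suppHom (T ∪ R) a s t else 0 := by
      intro p
      rw [suppHom_mul_apply hTR, suppHom_apply]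
      by_cases hp : p = ((fun i : T => s i), (fun i : T => t i))
      · subst hp
        simp only [mem_union, not_or, and_imp, Matrix.single_apply_same, one_mul, b,
          Matrix.of_apply, e1, if_true]
      · have : Matrix.single p.1 p.2 (1 : ℂ) (fun i : T => s i) (fun i : T => t i) = 0 := by
          rw [Matrix.single_apply, if_neg]
          rintro ⟨h1, h2⟩
          exact hp (Prod.ext h1 h2)
        rw [if_neg hp, this, zero_mul, ite_self]
    simp only [hterm, sum_ite_eq', mem_univ, if_true]
  rw [hsum] at key
  refine key.mono (le_of_eq ?_)
  simp only [Fintype.card_prod, Fintype.card_pi, Fintype.card_fin, prod_const, card_univ,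
    Fintype.card_coe]
  push_cast
  ring

end Support

/-! ### Nested commutators with a k-local Hamiltonian -/

section NestedCommutator

variable {𝒜 : Type*} [Ring 𝒜] [Algebra ℂ 𝒜]

/-- Splits off the innermost commutator instead of the outermost, so that an induction on m can let
the operator grow. -/
theorem adCoeff_succ_smul' (H V : 𝒜) (m : ℕ) :
    ((m : ℂ) + 1) • adCoeff H V (m + 1) = adCoeff H (V * H - H * V) m := by
  induction m with
  | zero => rw [adCoeff_succ_smul]; rfl
  | succ m ih =>
    have hm : (m : ℂ) + 1 ≠ 0 := by exact_mod_cast Nat.succ_ne_zero m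
    have h2 : adCoeff H (V * H - H * V) (m + 1) = -(((m : ℂ) + 1)⁻¹ •
      (H * adCoeff H (V * H - H * V) m - adCoeff H (V * H - H * V) m * H)) := rfl
    rw [h2, ← ih, adCoeff_succ_smul, mul_smul_comm, smul_mul_assoc, ← smul_sub, smul_smul,
      inv_mul_cancel₀ hm, one_smul, neg_sub]

/-- A union bound. -/
theorem sum_le_sum_sum_filter {α γ : Type*} {s : Finset α} {P : Finset γ} [Fintype α]
    {q : γ → α → Prop} [∀ p, DecidablePred (q p)] {f : α → ℝ} (hf : ∀ a, 0 ≤ f a)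
    (h : ∀ a ∈ s, ∃ p ∈ P, q p a) : ∑ a ∈ s, f a ≤ ∑ p ∈ P, ∑ a with q p a, f a := by
  classical
  calc ∑ a ∈ s, f a ≤ ∑ a ∈ s, ∑ p ∈ P, if q p a then f a else 0 := by
        refine sum_le_sum fun a ha => ?_
        obtain ⟨p, hp, hq⟩ := h a ha
        refine le_trans (by rw [if_pos hq])
          (single_le_sum (f := fun p => if q p a then f a else 0) (fun p _ => ?_) hp)
        split_ifs
        exacts [hf a, le_rfl]
    _ ≤ ∑ a, ∑ p ∈ P, if q p a then f a else 0 := by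
        refine sum_le_sum_of_subset_of_nonneg (subset_univ _) fun a _ _ =>
          sum_nonneg fun p _ => ?_
        split_ifs
        exacts [hf a, le_rfl]
    _ = _ := by
        rw [sum_comm]
        simp only [sum_filter]

variable {n d : ℕ}

/-- Only the terms meeting S contribute to the first commutator. Their norms add up to at most |S| g
≤ k p g, and the support grows by at most k sites, so p becomes p + 1. The factors p (p+1) ⋯ (p+m-1)
form the rising factorial, which is m! for p = 1 and then cancels. -/
theorem factorial_mul_norm_adCoeff_le {k : ℕ} {g : ℝ} (hg0 : 0 ≤ g) {h : Finset (Fin n) → Op n d}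
    (hsupp : ∀ Z, h Z ∈ suppAlg d Z) (hloc : ∀ Z, k < Z.card → h Z = 0)
    (hg : ∀ i, ∑ Z with i ∈ Z, ‖h Z‖ ≤ g) (m : ℕ) :
    ∀ (p : ℕ) (S : Finset (Fin n)) (O : Op n d), O ∈ suppAlg d S → S.card ≤ k * p →
      (m.factorial : ℝ) * ‖adCoeff (∑ Z, h Z) O m‖ ≤
        (2 * g * k) ^ m * p.ascFactorial m * ‖O‖ := by
  induction m with
  | zero => intro p S O _ _; simp [adCoeff]
  | succ m ih =>
    intro p S O hO hS
    have hnorm : ((m : ℝ) + 1) * ‖adCoeff (∑ Z, h Z) O (m + 1)‖ =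
        ‖adCoeff (∑ Z, h Z) (O * (∑ Z, h Z) - (∑ Z, h Z) * O) m‖ := by
      rw [← adCoeff_succ_smul', norm_smul]
      congr 1
      exact_mod_cast (Complex.norm_natCast (m + 1)).symm
    have hdecomp : O * (∑ Z, h Z) - (∑ Z, h Z) * O =
        ∑ Z with ¬ Disjoint S Z, (O * h Z - h Z * O) := by
      rw [mul_sum, sum_mul, ← sum_sub_distrib, sum_filter]
      refine sum_congr rfl fun Z _ => ?_
      by_cases hd : Disjoint S Z
      · rw [if_neg (not_not.2 hd), suppAlg_commute hd O hO _ (hsupp Z), sub_self]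
      · rw [if_pos hd]
    have hterm : ∀ Z, (m.factorial : ℝ) * ‖adCoeff (∑ Z, h Z) (O * h Z - h Z * O) m‖ ≤
        (2 * g * k) ^ m * (p + 1).ascFactorial m * (2 * ‖O‖) * ‖h Z‖ := by
      intro Z
      by_cases hZ : k < Z.card
      · have h0 : adCoeff (∑ Z, h Z) (0 : Op n d) m = 0 := by
          simpa using adCoeff_sum (∅ : Finset (Fin 0)) (∑ Z, h Z) (fun _ => (0 : Op n d)) m
        simp [hloc Z hZ, h0]
      · refine (ih (p + 1) (S ∪ Z) _ (sub_mem
          (mul_mem (suppAlg_mono subset_union_left hO) (suppAlg_mono subset_union_right (hsupp Z)))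
          (mul_mem (suppAlg_mono subset_union_right (hsupp Z))
            (suppAlg_mono subset_union_left hO))) ?_).trans ?_
        · refine (card_union_le _ _).trans ?_
          rw [mul_add, mul_one]
          omega
        · have hg1 : 0 ≤ (2 * g * k) ^ m := by
            positivity
          have h1 : ‖O * h Z - h Z * O‖ ≤ 2 * ‖O‖ * ‖h Z‖ := by
            refine (norm_sub_le _ _).trans ?_
            have := norm_mul_le O (h Z)
            have := norm_mul_le (h Z) O
            linarith
          calc _ ≤ (2 * g * k) ^ m * (p + 1).ascFactorial m * (2 * ‖O‖ * ‖h Z‖) := by gcongr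
            _ = _ := by ring
    have hgS : ∑ Z with ¬ Disjoint S Z, ‖h Z‖ ≤ k * p * g := by
      calc _ ≤ ∑ i ∈ S, ∑ Z with i ∈ Z, ‖h Z‖ :=
            sum_le_sum_sum_filter (fun _ => norm_nonneg _) fun Z hZ => by
              simpa [not_disjoint_iff] using hZ
        _ ≤ S.card * g := by
            refine (sum_le_sum fun i _ => hg i).trans ?_
            simp
        _ ≤ k * p * g := by
            gcongr
            exact_mod_cast hS
    have hasc : (p.ascFactorial (m + 1) : ℝ) = p * (p + 1).ascFactorial m := by
      rw [Nat.ascFactorial_succ, ← Nat.succ_ascFactorial]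
      push_cast
      ring
    calc ((m + 1).factorial : ℝ) * ‖adCoeff (∑ Z, h Z) O (m + 1)‖
        = m.factorial * ‖adCoeff (∑ Z, h Z) (O * (∑ Z, h Z) - (∑ Z, h Z) * O) m‖ := by
          rw [← hnorm, Nat.factorial_succ]
          push_cast
          ring
      _ ≤ ∑ Z with ¬ Disjoint S Z,
            (m.factorial : ℝ) * ‖adCoeff (∑ Z, h Z) (O * h Z - h Z * O) m‖ := by
          rw [hdecomp, adCoeff_sum, ← mul_sum]
          gcongr
          exact norm_sum_le _ _
      _ ≤ (2 * g * k) ^ m * (p + 1).ascFactorial m * (2 * ‖O‖) *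
            ∑ Z with ¬ Disjoint S Z, ‖h Z‖ := by
          rw [mul_sum]
          exact sum_le_sum fun Z _ => hterm Z
      _ ≤ (2 * g * k) ^ m * (p + 1).ascFactorial m * (2 * ‖O‖) * (k * p * g) := by
          gcongr
      _ = _ := by
          rw [hasc, pow_succ]
          ring

theorem norm_adCoeff_le {k : ℕ} {g : ℝ} (hg0 : 0 ≤ g) {h : Finset (Fin n) → Op n d}
    (hsupp : ∀ Z, h Z ∈ suppAlg d Z) (hloc : ∀ Z, k < Z.card → h Z = 0)
    (hg : ∀ i, ∑ Z with i ∈ Z, ‖h Z‖ ≤ g) {S : Finset (Fin n)} {O : Op n d}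
    (hO : O ∈ suppAlg d S) (hS : S.card ≤ k) (m : ℕ) :
    ‖adCoeff (∑ Z, h Z) O m‖ ≤ (2 * g * k) ^ m * ‖O‖ := by
  have := factorial_mul_norm_adCoeff_le hg0 hsupp hloc hg m 1 S O hO (by simpa using hS)
  rw [Nat.one_ascFactorial, mul_comm ((2 * g * k) ^ m), mul_assoc] at this
  exact le_of_mul_le_mul_left this (by positivity)

end NestedCommutator
-- Weights, ranks and decay as functions of the range
section PowerSums

/-- Comparison with the integral of x^{-p} over [r, r+1], obtained from log u ≤ u - 1 and 1 + u ≤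
e^u. It makes the sum of r^{-p} telescope. -/
theorem rpow_neg_le_sub {p : ℝ} (hp : 1 < p) {r : ℕ} (hr : 1 ≤ r) :
    (p - 1) * ((r + 1 : ℕ) : ℝ) ^ (-p) ≤ (r : ℝ) ^ (1 - p) - ((r + 1 : ℕ) : ℝ) ^ (1 - p) := by
  have hr0 : (0 : ℝ) < r := by exact_mod_cast hr
  set x : ℝ := ((r + 1 : ℕ) : ℝ) with hx
  have hx0 : 0 < x := by positivity
  have hxr : (r : ℝ) = x - 1 := by rw [hx]; push_cast; ring
  have h1 : (r : ℝ) ^ (1 - p) = x ^ (1 - p) * (r / x) ^ (1 - p) := by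
    rw [← Real.mul_rpow hx0.le (by positivity)]
    congr 1
    field_simp
  have h2 : 1 + (p - 1) / x ≤ (r / x) ^ (1 - p) := by
    rw [Real.rpow_def_of_pos (by positivity)]
    have h3 : Real.log (r / x) ≤ -(1 / x) := by
      refine (Real.log_le_sub_one_of_pos (by positivity)).trans (le_of_eq ?_)
      rw [hxr]
      field_simp
      ring
    have h4 := Real.add_one_le_exp (Real.log (r / x) * (1 - p))
    have h5 : (p - 1) / x ≤ Real.log (r / x) * (1 - p) := by
      have := mul_le_mul_of_nonneg_right h3 (by linarith : 0 ≤ p - 1)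
      rw [div_eq_mul_one_div]
      nlinarith
    linarith
  have h6 : x ^ (-p) = x ^ (1 - p) * (1 / x) := by
    rw [show -p = (1 - p) - 1 by ring, Real.rpow_sub_one hx0.ne']
    ring
  rw [h1, h6]
  have h7 : 0 ≤ x ^ (1 - p) := by positivity
  have := mul_le_mul_of_nonneg_left h2 h7
  calc _ = x ^ (1 - p) * (1 + (p - 1) / x) - x ^ (1 - p) := by ring
    _ ≤ _ := by linarith

theorem sum_rpow_neg_le {p : ℝ} (hp : 1 < p) (n : ℕ) :
    ∑ r ∈ range n, (r : ℝ) ^ (-p) ≤ p / (p - 1) := by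
  have hp1 : 0 < p - 1 := by linarith
  have key : ∀ m : ℕ, ∑ r ∈ range (m + 2), (r : ℝ) ^ (-p) ≤
      1 + (1 - ((m + 1 : ℕ) : ℝ) ^ (1 - p)) / (p - 1) := by
    intro m
    induction m with
    | zero =>
      -- The term r = 0 vanishes, as 0 to a nonzero real power is 0.
      have : -p ≠ 0 := by linarith
      simp [sum_range_succ, Real.zero_rpow this]
    | succ m ih =>
      rw [sum_range_succ]
      have h := rpow_neg_le_sub hp (Nat.succ_le_succ (Nat.zero_le m))
      have h2 : ((m + 2 : ℕ) : ℝ) ^ (-p) ≤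
          (((m + 1 : ℕ) : ℝ) ^ (1 - p) - ((m + 2 : ℕ) : ℝ) ^ (1 - p)) / (p - 1) := by
        rw [le_div_iff₀ hp1, mul_comm]
        exact h
      calc _ ≤ 1 + (1 - ((m + 1 : ℕ) : ℝ) ^ (1 - p)) / (p - 1) +
          (((m + 1 : ℕ) : ℝ) ^ (1 - p) - ((m + 2 : ℕ) : ℝ) ^ (1 - p)) / (p - 1) :=
            add_le_add ih h2
        _ = _ := by rw [add_assoc, ← add_div]; ring_nf
  calc ∑ r ∈ range n, (r : ℝ) ^ (-p) ≤ ∑ r ∈ range (n + 2), (r : ℝ) ^ (-p) :=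
        sum_le_sum_of_subset_of_nonneg (range_mono (by omega)) fun _ _ _ => by positivity
    _ ≤ 1 + (1 - ((n + 1 : ℕ) : ℝ) ^ (1 - p)) / (p - 1) := key n
    _ ≤ 1 + 1 / (p - 1) := by
        gcongr
        have : 0 ≤ ((n + 1 : ℕ) : ℝ) ^ (1 - p) := by positivity
        linarith
    _ = _ := by field_simp; ring

/-- The weight of an interaction of range `r`. -/
def rangeWeight (η : ℝ) (r : ℕ) : ℕ := ⌊(η - 2) / 2 * Real.logb 2 r⌋₊ + 1

theorem two_rpow_mul_logb {r : ℕ} (hr : 1 ≤ r) (a : ℝ) :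
    (2 : ℝ) ^ (a * Real.logb 2 r) = (r : ℝ) ^ a := by
  have hr0 : (0 : ℝ) < r := by exact_mod_cast hr
  rw [mul_comm, Real.rpow_mul (by norm_num), Real.rpow_logb (by norm_num) (by norm_num) hr0]

/-- The weight spends half of the surplus decay η - 2. This upper bound serves convergence, the
lower bound below serves the rank count. -/
theorem two_pow_rangeWeight_le {η : ℝ} (hη : 2 < η) {r : ℕ} (hr : 1 ≤ r) :
    (2 : ℝ) ^ rangeWeight η r ≤ 2 * (r : ℝ) ^ ((η - 2) / 2) := by
  have hr1 : (1 : ℝ) ≤ r := by exact_mod_cast hr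
  have h0 : 0 ≤ (η - 2) / 2 * Real.logb 2 r :=
    mul_nonneg (by linarith) (Real.logb_nonneg (by norm_num) hr1)
  rw [rangeWeight, pow_succ, mul_comm, ← two_rpow_mul_logb hr, ← Real.rpow_natCast]
  gcongr
  · norm_num
  · exact Nat.floor_le h0

theorem rpow_le_two_pow_rangeWeight {η : ℝ} {r : ℕ} (hr : 1 ≤ r) :
    (r : ℝ) ^ ((η - 2) / 2) ≤ (2 : ℝ) ^ rangeWeight η r := by
  rw [rangeWeight, ← two_rpow_mul_logb hr, ← Real.rpow_natCast]
  refine Real.rpow_le_rpow_of_exponent_le (by norm_num) ?_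
  push_cast
  exact (Nat.lt_floor_add_one _).le

/-- The exponent of the Schmidt rank of the truncated expansion. -/
def rankExponent (k d : ℕ) (η : ℝ) : ℝ := 2 + 2 * k * Real.logb 2 d + 4 * (k + 1) / (η - 2)

theorem two_le_rankExponent {k d : ℕ} {η : ℝ} (hd : 1 ≤ d) (hη : 2 < η) :
    2 ≤ rankExponent k d η := by
  have h1 : 0 ≤ Real.logb 2 d := Real.logb_nonneg (by norm_num) (by exact_mod_cast hd)
  have h2 : 0 < η - 2 := by linarith
  have h3 : 0 ≤ 2 * (k : ℝ) * Real.logb 2 d + 4 * (k + 1) / (η - 2) := by positivity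
  rw [rankExponent]
  linarith

/-- Each summand of `rankExponent` has its task: 2 supplies the factor 1/4, 2k log₂ d pays for
d^{2k}, and 4(k+1)/(η-2) turns r^{(η-2)/2} into r^{2(k+1)}, which beats r^k with r^{-2} to spare.
The first two use that every weight is at least 1. -/
theorem sum_rank_mul_weight_le {k d : ℕ} {η : ℝ} (hk : 1 ≤ k) (hd : 1 ≤ d) (hη : 2 < η) (n : ℕ) :
    ∑ r : Fin n, ((r : ℕ) : ℝ) ^ k * (d : ℝ) ^ (2 * k) *
      ((2 : ℝ) ^ (-rankExponent k d η)) ^ rangeWeight η r ≤ 1 / 2 := by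
  have hη2 : 0 < η - 2 := by linarith
  have hd0 : (0 : ℝ) < d := by exact_mod_cast hd
  have hlog : 0 ≤ Real.logb 2 d := Real.logb_nonneg (by norm_num) (by exact_mod_cast hd)
  have hterm : ∀ r : ℕ, (r : ℝ) ^ k * (d : ℝ) ^ (2 * k) *
      ((2 : ℝ) ^ (-rankExponent k d η)) ^ rangeWeight η r ≤ (r : ℝ) ^ (-2 : ℝ) * (1 / 4) := by
    intro r
    rcases Nat.eq_zero_or_pos r with rfl | hr
    · rw [Nat.cast_zero, zero_pow (by omega), Real.zero_rpow (by norm_num)]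
      simp
    have hr0 : (0 : ℝ) < r := by exact_mod_cast hr
    have hr1 : (1 : ℝ) ≤ r := by exact_mod_cast hr
    set w := rangeWeight η r with hw
    have hw1 : (1 : ℝ) ≤ w := by
      rw [hw, rangeWeight]; push_cast; linarith [Nat.cast_nonneg (α := ℝ) ⌊(η - 2) / 2 * Real.logb 2 r⌋₊]
    have h1 : (r : ℝ) ^ (2 * (k + 1)) ≤ (2 : ℝ) ^ (w * (4 * (k + 1) / (η - 2))) := by
      rw [Real.rpow_mul (by norm_num), Real.rpow_natCast]
      calc (r : ℝ) ^ (2 * (k + 1)) = ((r : ℝ) ^ ((η - 2) / 2)) ^ (4 * ((k : ℝ) + 1) / (η - 2)) := by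
            rw [← Real.rpow_mul hr0.le, ← Real.rpow_natCast]
            congr 1
            push_cast
            field_simp
            ring
        _ ≤ _ := by
            refine Real.rpow_le_rpow (by positivity) (rpow_le_two_pow_rangeWeight hr) (by positivity)
    have h2 : (d : ℝ) ^ (2 * k) ≤ (2 : ℝ) ^ (w * (2 * k * Real.logb 2 d)) := by
      calc (d : ℝ) ^ (2 * k) = (2 : ℝ) ^ (2 * k * Real.logb 2 d) := by
            rw [two_rpow_mul_logb hd, ← Real.rpow_natCast]
            push_cast
            rfl
        _ ≤ _ := by
            refine Real.rpow_le_rpow_of_exponent_le (by norm_num) ?_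
            exact le_mul_of_one_le_left (by positivity) hw1
    have h3 : (4 : ℝ) ≤ (2 : ℝ) ^ ((w : ℝ) * 2) := by
      calc (4 : ℝ) = (2 : ℝ) ^ (2 : ℝ) := by norm_num
        _ ≤ _ := Real.rpow_le_rpow_of_exponent_le (by norm_num) (by linarith)
    have h4 : ((2 : ℝ) ^ (-rankExponent k d η)) ^ w = ((2 : ℝ) ^ ((w : ℝ) * 2) *
        (2 : ℝ) ^ (w * (2 * k * Real.logb 2 d)) * (2 : ℝ) ^ (w * (4 * ((k : ℝ) + 1) / (η - 2))))⁻¹ := by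
      rw [← Real.rpow_add (by norm_num), ← Real.rpow_add (by norm_num),
        ← Real.rpow_neg (by norm_num), ← Real.rpow_natCast, ← Real.rpow_mul (by norm_num),
        rankExponent]
      congr 1
      ring
    rw [h4, ← div_eq_mul_inv, div_le_iff₀ (by positivity)]
    have h5 : (r : ℝ) ^ k ≤ (r : ℝ) ^ (-2 : ℝ) * (r : ℝ) ^ (2 * (k + 1)) := by
      rw [Real.rpow_neg hr0.le, inv_mul_eq_div, le_div_iff₀ (by positivity), Real.rpow_two,
        ← pow_add]
      exact pow_le_pow_right₀ hr1 (by omega)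
    calc (r : ℝ) ^ k * (d : ℝ) ^ (2 * k)
        ≤ ((r : ℝ) ^ (-2 : ℝ) * (2 : ℝ) ^ (w * (4 * ((k : ℝ) + 1) / (η - 2)))) *
          (2 : ℝ) ^ (w * (2 * k * Real.logb 2 d)) := by
          refine mul_le_mul (h5.trans ?_) h2 (by positivity) (by positivity)
          gcongr
      _ = (r : ℝ) ^ (-2 : ℝ) * (1 / 4) * (4 * (2 : ℝ) ^ (w * (2 * k * Real.logb 2 d)) *
          (2 : ℝ) ^ (w * (4 * ((k : ℝ) + 1) / (η - 2)))) := by ring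
      _ ≤ _ := by gcongr
  calc _ ≤ ∑ r : Fin n, ((r : ℕ) : ℝ) ^ (-2 : ℝ) * (1 / 4) := sum_le_sum fun r _ => hterm r
    _ = (∑ r ∈ range n, (r : ℝ) ^ (-2 : ℝ)) * (1 / 4) := by
        rw [← sum_mul, Fin.sum_univ_eq_sum_range (fun r => (r : ℝ) ^ (-2 : ℝ))]
    _ ≤ 2 / (2 - 1) * (1 / 4) := by
        gcongr
        exact sum_rpow_neg_le (by norm_num) n
    _ = 1 / 2 := by norm_num

/-- The exponents (η-2)/2, 1 and -η add up to -η/2 < -1, so the sum is at most 2Jη/(η-2). The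
hypothesis on J is stronger than needed, by η ≤ 2(η-1)². -/
theorem sum_weight_mul_decay_le {η J : ℝ} (hη : 2 < η) (hJ0 : 0 ≤ J)
    (hJ : J * (16 * Real.exp 1 * (η - 1) ^ 2 * (2 : ℝ) ^ (η - 2)) ≤ η - 2) (n : ℕ) :
    ∑ r : Fin n, (2 : ℝ) ^ rangeWeight η r *
      (((r : ℕ) : ℝ) * (J * ((r : ℕ) : ℝ) ^ (-η))) ≤ 1 / 4 := by
  have hη2 : 0 < η - 2 := by linarith
  have hterm : ∀ r : ℕ, (2 : ℝ) ^ rangeWeight η r * ((r : ℝ) * (J * (r : ℝ) ^ (-η))) ≤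
      2 * J * (r : ℝ) ^ (-(η / 2)) := by
    intro r
    rcases Nat.eq_zero_or_pos r with rfl | hr
    · simp only [Nat.cast_zero, zero_mul, mul_zero]
      positivity
    have hr0 : (0 : ℝ) < r := by exact_mod_cast hr
    calc _ ≤ 2 * (r : ℝ) ^ ((η - 2) / 2) * ((r : ℝ) * (J * (r : ℝ) ^ (-η))) := by
          gcongr
          exact two_pow_rangeWeight_le hη hr
      _ = 2 * J * ((r : ℝ) ^ ((η - 2) / 2) * (r : ℝ) ^ (1 : ℝ) * (r : ℝ) ^ (-η)) := by
          rw [Real.rpow_one]; ring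
      _ = _ := by
          rw [← Real.rpow_add hr0, ← Real.rpow_add hr0]
          congr 2
          ring
  calc _ ≤ ∑ r : Fin n, 2 * J * ((r : ℕ) : ℝ) ^ (-(η / 2)) := sum_le_sum fun r _ => hterm r
    _ = 2 * J * ∑ r ∈ range n, (r : ℝ) ^ (-(η / 2)) := by
        rw [← mul_sum, Fin.sum_univ_eq_sum_range (fun r => (r : ℝ) ^ (-(η / 2)))]
    _ ≤ 2 * J * ((η / 2) / (η / 2 - 1)) := by
        gcongr
        exact sum_rpow_neg_le (by linarith) n
    _ = 2 * J * η / (η - 2) := by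
        have : η / 2 - 1 ≠ 0 := by linarith
        field_simp
    _ ≤ 1 / 4 := by
        rw [div_le_iff₀ hη2]
        refine le_trans ?_ (mul_le_mul_of_nonneg_left hJ (by norm_num))
        have e1 : (1 : ℝ) ≤ Real.exp 1 := Real.one_le_exp (by norm_num)
        have e2 : (1 : ℝ) ≤ (2 : ℝ) ^ (η - 2) := Real.one_le_rpow (by norm_num) hη2.le
        have e3 : 1 ≤ Real.exp 1 * (2 : ℝ) ^ (η - 2) := one_le_mul_of_one_le_of_one_le e1 e2
        have e4 : η ≤ 2 * (η - 1) ^ 2 := by nlinarith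
        calc 2 * J * η ≤ 2 * J * (2 * (η - 1) ^ 2) := by gcongr
          _ ≤ 2 * J * (2 * (η - 1) ^ 2) * (Real.exp 1 * (2 : ℝ) ^ (η - 2)) :=
              le_mul_of_one_le_right (by positivity) e3
          _ = _ := by ring

end PowerSums
-- Interactions across a cut
section Cut

variable {n d : ℕ}

/-- The sites to the left of the cut `c`. -/
def leftSites (n c : ℕ) : Finset (Fin n) := univ.filter fun i => (i : ℕ) < c

theorem mem_leftSites {c : ℕ} {i : Fin n} : i ∈ leftSites n c ↔ (i : ℕ) < c := by
  simp [leftSites]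

/-- `Z` has sites on both sides of the cut `c`. -/
def Crosses (c : ℕ) (Z : Finset (Fin n)) : Prop :=
  ¬ Z ⊆ leftSites n c ∧ ¬ Z ⊆ (leftSites n c)ᶜ

instance (c : ℕ) : DecidablePred (Crosses (n := n) c) := fun _ => instDecidableAnd

/-- The distance of the extreme sites of `Z`. -/
def span (Z : Finset (Fin n)) : ℕ := (Z ×ˢ Z).sup fun p => (p.2 : ℕ) - (p.1 : ℕ)

theorem sub_le_span {Z : Finset (Fin n)} {i j : Fin n} (hi : i ∈ Z) (hj : j ∈ Z) :
    (j : ℕ) - i ≤ span Z :=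
  le_sup (f := fun p : Fin n × Fin n => (p.2 : ℕ) - (p.1 : ℕ)) (mk_mem_product hi hj)

theorem span_lt (hn : 1 ≤ n) (Z : Finset (Fin n)) : span Z < n := by
  rw [span, Finset.sup_lt_iff (by exact hn)]
  intro p _
  have := p.2.2
  omega

theorem Crosses.exists_mem {c : ℕ} {Z : Finset (Fin n)} (h : Crosses c Z) :
    (∃ i ∈ Z, (i : ℕ) < c) ∧ ∃ j ∈ Z, c ≤ (j : ℕ) := by
  obtain ⟨h1, h2⟩ := h
  rw [not_subset] at h1 h2
  obtain ⟨j, hj, hj'⟩ := h1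
  obtain ⟨i, hi, hi'⟩ := h2
  rw [mem_leftSites] at hj'
  rw [mem_compl, not_not, mem_leftSites] at hi'
  exact ⟨⟨i, hi, hi'⟩, j, hj, not_lt.1 hj'⟩

/-- A pair realizing the maximal distance must straddle the cut, since Z has sites on both sides. -/
theorem Crosses.exists_span_eq {c : ℕ} {Z : Finset (Fin n)} (h : Crosses c Z) :
    ∃ i ∈ Z, ∃ j ∈ Z, (i : ℕ) < c ∧ c ≤ (j : ℕ) ∧ (j : ℕ) = i + span Z := by
  obtain ⟨⟨i₀, hi₀, hi₀c⟩, j₀, hj₀, hj₀c⟩ := h.exists_mem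
  obtain ⟨⟨i, j⟩, hp, hs⟩ := exists_mem_eq_sup (Z ×ˢ Z) ⟨_, mk_mem_product hi₀ hj₀⟩
    fun p => (p.2 : ℕ) - (p.1 : ℕ)
  obtain ⟨hi, hj⟩ : i ∈ Z ∧ j ∈ Z := mem_product.1 hp
  have hs' : span Z = (j : ℕ) - i := hs
  have h1 := sub_le_span hi₀ hj₀
  have h2 := sub_le_span hi₀ hj
  have h3 := sub_le_span hi hj₀
  exact ⟨i, hi, j, hj, by omega, by omega, by omega⟩

/-- The sum of the terms of range `r` that cross the cut `c`. -/
def crossingSum (c : ℕ) (h : Finset (Fin n) → Op n d) (r : ℕ) : Op n d :=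
  ∑ Z with Crosses c Z ∧ span Z = r, h Z

/-- The family of the terms that do not cross the cut `c`. -/
def uncrossed (c : ℕ) (h : Finset (Fin n) → Op n d) (Z : Finset (Fin n)) : Op n d :=
  if Crosses c Z then 0 else h Z

theorem hamiltonian_eq (hn : 1 ≤ n) (c : ℕ) (h : Finset (Fin n) → Op n d) :
    hamiltonian h = ∑ Z, uncrossed c h Z + ∑ r : Fin n, crossingSum c h r := by
  have h1 : ∑ r : Fin n, crossingSum c h r = ∑ Z with Crosses c Z, h Z := by
    rw [← sum_fiberwise (univ.filter (Crosses c)) (fun Z => (⟨span Z, span_lt hn Z⟩ : Fin n)) h]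
    refine sum_congr rfl fun r _ => ?_
    rw [crossingSum, filter_filter]
    simp only [Fin.ext_iff]
  rw [h1, sum_filter, ← sum_add_distrib, hamiltonian]
  refine sum_congr rfl fun Z _ => ?_
  rw [uncrossed]
  split_ifs <;> simp

variable {k : ℕ} {g J η : ℝ} {h : Finset (Fin n) → Op n d}

theorem IsPowerLawInteraction.mem_suppAlg (hh : IsPowerLawInteraction k g J η h)
    (Z : Finset (Fin n)) : h Z ∈ suppAlg d Z :=
  LongRangeGibbs.mem_suppAlg.2 (hh.supportedOn Z)

theorem IsPowerLawInteraction.site_energy_norm (hh : IsPowerLawInteraction k g J η h)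
    (i : Fin n) : ∑ Z with i ∈ Z, ‖h Z‖ ≤ g := hh.site_energy i

theorem IsPowerLawInteraction.decay_norm (hh : IsPowerLawInteraction k g J η h)
    {i j : Fin n} (hij : i ≠ j) : ∑ Z with i ∈ Z ∧ j ∈ Z, ‖h Z‖ ≤
      J * |((i : ℕ) : ℝ) - ((j : ℕ) : ℝ)| ^ (-η) := hh.decay i j hij

/-- Each such Z contains a pair (i, i + r) straddling the cut. There are at most r such pairs, and
the decay assumption bounds the terms containing each. -/
theorem sum_norm_crossing_le (hh : IsPowerLawInteraction k g J η h) (hJ : 0 ≤ J) (c r : ℕ) :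
    ∑ Z with Crosses c Z ∧ span Z = r, ‖h Z‖ ≤ r * (J * (r : ℝ) ^ (-η)) := by
  set P : Finset (Fin n × Fin n) :=
    univ.filter fun p => (p.1 : ℕ) < c ∧ c ≤ (p.2 : ℕ) ∧ (p.2 : ℕ) = p.1 + r with hP
  have hcard : P.card ≤ r := by
    calc P.card ≤ (Finset.Ico (c - r) c).card := by
          refine card_le_card_of_injOn (fun p => (p.1 : ℕ)) ?_ ?_
          · intro p hp
            simp only [hP, coe_filter, mem_univ, true_and, Set.mem_ofPred_eq] at hp
            simp only [coe_Ico, Set.mem_Ico]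
            omega
          · intro p hp q hq hpq
            simp only [hP, coe_filter, mem_univ, true_and, Set.mem_ofPred_eq] at hp hq hpq
            exact Prod.ext (Fin.ext hpq) (Fin.ext (by omega))
      _ ≤ r := by rw [Nat.card_Ico]; omega
  have h0 : 0 ≤ J * (r : ℝ) ^ (-η) := by positivity
  calc ∑ Z with Crosses c Z ∧ span Z = r, ‖h Z‖
      ≤ ∑ p ∈ P, ∑ Z with p.1 ∈ Z ∧ p.2 ∈ Z, ‖h Z‖ := by
        refine sum_le_sum_sum_filter (P := P) (f := fun Z => ‖h Z‖)
          (q := fun p Z => p.1 ∈ Z ∧ p.2 ∈ Z)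
          (fun _ => norm_nonneg _) fun Z hZ => ?_
        simp only [mem_filter, mem_univ, true_and] at hZ
        obtain ⟨i, hi, j, hj, h1, h2, h3⟩ := hZ.1.exists_span_eq
        refine ⟨(i, j), ?_, hi, hj⟩
        simp only [hP, mem_filter, mem_univ, true_and]
        exact ⟨h1, h2, by rw [h3, hZ.2]⟩
    _ ≤ ∑ p ∈ P, J * (r : ℝ) ^ (-η) := by
        refine sum_le_sum fun p hp => ?_
        simp only [hP, mem_filter, mem_univ, true_and] at hp
        refine (hh.decay_norm (fun he => ?_)).trans (le_of_eq ?_)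
        · rw [he] at hp; omega
        · congr 2
          rw [hp.2.2]
          push_cast
          rw [sub_add_cancel_left, abs_neg, Nat.abs_cast]
    _ ≤ r * (J * (r : ℝ) ^ (-η)) := by
        rw [sum_const, nsmul_eq_mul]
        exact mul_le_mul_of_nonneg_right (by exact_mod_cast hcard) h0

/-- Supplies the convergence hypothesis of `exists_mul_exp_eq`: 2gk ≤ 1/4 makes the m-th commutator
decay like 4^{-m}, half of which (in exponent) pays for the weight m. -/
theorem sum_weight_norm_adCoeff_le (hη : 2 < η) (hh : IsPowerLawInteraction k g J η h)
    (hg : 0 ≤ g) (hJ0 : 0 ≤ J) (hgk : 8 * g * k ≤ 1)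
    (hJ : J * (16 * Real.exp 1 * (η - 1) ^ 2 * (2 : ℝ) ^ (η - 2)) ≤ η - 2) (c m : ℕ) :
    ∑ r : Fin n, (2 : ℝ) ^ (rangeWeight η r + m) *
      ‖adCoeff (∑ Z, uncrossed c h Z) (crossingSum c h r) m‖ ≤ (1 / 2) ^ m / 4 := by
  have hterm : ∀ r : ℕ, ‖adCoeff (∑ Z, uncrossed c h Z) (crossingSum c h r) m‖ ≤
      (1 / 4) ^ m * (r * (J * (r : ℝ) ^ (-η))) := by
    intro r
    rw [crossingSum, adCoeff_sum]
    refine (norm_sum_le _ _).trans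
      (le_trans ?_ (mul_le_mul_of_nonneg_left (sum_norm_crossing_le hh hJ0 c r) (by positivity)))
    rw [mul_sum]
    refine sum_le_sum fun Z _ => ?_
    by_cases hZ : k < Z.card
    · have h0 : adCoeff (∑ Z, uncrossed c h Z) (0 : Op n d) m = 0 := by
        simpa using adCoeff_sum (∅ : Finset (Fin 0)) (∑ Z, uncrossed c h Z)
          (fun _ => (0 : Op n d)) m
      simp [hh.local_terms Z hZ, h0]
    · refine (norm_adCoeff_le hg (h := uncrossed c h) (k := k) ?_ ?_ ?_
        (hh.mem_suppAlg Z) (not_lt.1 hZ) m).trans ?_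
      · intro Z
        rw [uncrossed]
        split_ifs
        exacts [zero_mem _, hh.mem_suppAlg Z]
      · intro Z hZ
        rw [uncrossed, hh.local_terms Z hZ, ite_self]
      · intro i
        refine (sum_le_sum fun Z _ => ?_).trans (hh.site_energy_norm i)
        rw [uncrossed]
        split_ifs
        · rw [norm_zero]; exact norm_nonneg _
        · exact le_rfl
      · gcongr
        linarith
  calc _ ≤ ∑ r : Fin n, (1 / 2 : ℝ) ^ m * ((2 : ℝ) ^ rangeWeight η r *
        (((r : ℕ) : ℝ) * (J * ((r : ℕ) : ℝ) ^ (-η)))) := by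
        refine sum_le_sum fun r _ => ?_
        refine (mul_le_mul_of_nonneg_left (hterm r) (by positivity)).trans (le_of_eq ?_)
        have : (1 / 2 : ℝ) ^ m = 2 ^ m * (1 / 4) ^ m := by rw [← mul_pow]; norm_num
        rw [this, pow_add]
        ring
    _ ≤ _ := by
        rw [← mul_sum, div_eq_mul_one_div ((1 / 2 : ℝ) ^ m)]
        gcongr
        exact sum_weight_mul_decay_le hη hJ0 hJ n

/-- A nonempty set of at most k elements is the image of a map from `Fin k`. -/
theorem card_powerset_filter_le {α : Type*} [DecidableEq α] (Λ : Finset α) (k : ℕ) :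
    (Λ.powerset.filter fun T => T.Nonempty ∧ T.card ≤ k).card ≤ Λ.card ^ k := by
  calc _ ≤ ((univ : Finset (Fin k → Λ)).image fun f => univ.image fun a => (f a : α)).card := by
        refine card_le_card fun T hT => ?_
        simp only [mem_filter, mem_powerset] at hT
        obtain ⟨hT, hne, hk⟩ := hT
        have : Nonempty T := hne.to_subtype
        obtain ⟨e⟩ : Nonempty (T ↪ Fin k) :=
          Function.Embedding.nonempty_of_card_le (by simpa using hk)
        obtain ⟨f, hs⟩ : ∃ f : Fin k → T, Function.Surjective f :=
          ⟨Function.invFun e, Function.invFun_surjective e.injective⟩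
        refine mem_image.2 ⟨fun a => ⟨f a, hT (f a).2⟩,
          mem_univ _, ?_⟩
        ext x
        simp only [mem_image, mem_univ, true_and]
        constructor
        · rintro ⟨a, rfl⟩
          exact (f a).2
        · intro hx
          obtain ⟨a, ha⟩ := hs ⟨x, hx⟩
          exact ⟨a, by rw [ha]⟩
    _ ≤ _ := by
        refine card_image_le.trans ?_
        simp

/-- The terms are grouped by their left part T, a nonempty set of at most k of the r sites next to
the cut, which leaves at most r^k groups. A whole group acts on T and the right half, so it has rank
at most d^{2k} however many right parts occur. -/
theorem schmidtLE_crossingSum (hd : 1 ≤ d) (hh : IsPowerLawInteraction k g J η h) (c r : ℕ) :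
    SchmidtLE (suppAlg d (leftSites n c)) (suppAlg d (leftSites n c)ᶜ) (crossingSum c h r)
      ((r : ℝ) ^ k * (d : ℝ) ^ (2 * k)) := by
  set Λ : Finset (Fin n) := univ.filter fun i => (i : ℕ) < c ∧ c ≤ (i : ℕ) + r with hΛ
  set 𝒯 := Λ.powerset.filter fun T => T.Nonempty ∧ T.card ≤ k with h𝒯
  have hcard : Λ.card ≤ r := by
    calc Λ.card ≤ (Finset.Ico (c - r) c).card := by
          refine card_le_card_of_injOn (fun i => (i : ℕ)) ?_ ?_
          · intro i hi
            simp only [hΛ, coe_filter, mem_univ, true_and, Set.mem_ofPred_eq] at hi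
            simp only [coe_Ico, Set.mem_Ico]
            omega
          · intro i _ j _ hij
            exact Fin.ext hij
      _ ≤ r := by rw [Nat.card_Ico]; omega
  have hΛl : ∀ T ∈ 𝒯, T ⊆ leftSites n c := fun T hT i hi => by
    have := mem_powerset.1 (mem_filter.1 hT).1 hi
    simp only [hΛ, mem_filter, mem_univ, true_and] at this
    exact mem_leftSites.2 this.1
  have hsum : crossingSum c h r =
      ∑ T ∈ 𝒯, ∑ Z with (Crosses c Z ∧ span Z = r) ∧ Z ∩ leftSites n c = T, h Z := by
    have h1 : crossingSum c h r = ∑ Z with (Crosses c Z ∧ span Z = r) ∧ Z.card ≤ k, h Z := by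
      rw [crossingSum, ← filter_filter (fun Z => Crosses c Z ∧ span Z = r)]
      refine (sum_filter_of_ne (p := fun Z : Finset (Fin n) => Z.card ≤ k) fun Z _ hZ => ?_).symm
      by_contra hlt
      exact hZ (hh.local_terms Z (not_le.1 hlt))
    have h2 : ∀ Z ∈ univ.filter (fun Z : Finset (Fin n) =>
        (Crosses c Z ∧ span Z = r) ∧ Z.card ≤ k), Z ∩ leftSites n c ∈ 𝒯 := by
      intro Z hZ
      simp only [mem_filter, mem_univ, true_and] at hZ
      obtain ⟨⟨hc, hs⟩, hk⟩ := hZ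
      obtain ⟨i, hi, j, hj, hic, hjc, hij⟩ := hc.exists_span_eq
      simp only [h𝒯, mem_filter, mem_powerset]
      refine ⟨fun a ha => ?_, ⟨i, mem_inter.2 ⟨hi, mem_leftSites.2 hic⟩⟩,
        (card_le_card inter_subset_left).trans hk⟩
      rw [mem_inter, mem_leftSites] at ha
      have := sub_le_span ha.1 hj
      simp only [hΛ, mem_filter, mem_univ, true_and]
      omega
    rw [h1, ← sum_fiberwise_of_maps_to h2]
    refine sum_congr rfl fun T _ => ?_
    rw [filter_filter]
    refine sum_subset_zero_on_sdiff (fun Z hZ => ?_) (fun Z hZ => ?_) fun _ _ => rfl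
    · simp only [mem_filter, mem_univ, true_and] at hZ ⊢
      exact ⟨hZ.1.1, hZ.2⟩
    · simp only [mem_sdiff, mem_filter, mem_univ, true_and] at hZ
      refine hh.local_terms Z (not_le.1 fun hk => hZ.2 ⟨⟨hZ.1.1, hk⟩, hZ.1.2⟩)
  rw [hsum]
  have hd1 : (1 : ℝ) ≤ d := by exact_mod_cast hd
  refine (SchmidtLE.sum (a := fun _ => (d : ℝ) ^ (2 * k)) fun T hT => ?_).mono ?_
  · have hTl := hΛl T hT
    have hdisj : Disjoint T (leftSites n c)ᶜ :=
      disjoint_of_subset_left hTl disjoint_compl_right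
    obtain ⟨m, hm, l, s, hl, hs, he⟩ := schmidtLE_of_mem_union (d := d) hdisj
      (A := ∑ Z with (Crosses c Z ∧ span Z = r) ∧ Z ∩ leftSites n c = T, h Z) (by
        refine sum_mem fun Z hZ => suppAlg_mono (fun i hi => ?_) (hh.mem_suppAlg Z)
        simp only [mem_filter, mem_univ, true_and] at hZ
        rw [mem_union, ← hZ.2, mem_inter, mem_compl]
        tauto)
    refine ⟨m, hm.trans (pow_le_pow_right₀ hd1 ?_), l, s, fun i => suppAlg_mono hTl (hl i), hs, he⟩
    have := (mem_filter.1 hT).2.2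
    omega
  · rw [sum_const, nsmul_eq_mul]
    gcongr
    have := (card_powerset_filter_le Λ k).trans (Nat.pow_le_pow_left hcard k)
    exact_mod_cast this

theorem exp_mem_suppAlg {Z : Finset (Fin n)} {A : Op n d} (hA : A ∈ suppAlg d Z) :
    NormedSpace.exp A ∈ suppAlg d Z := by
  obtain ⟨a, rfl⟩ := hA
  refine ⟨NormedSpace.exp a, ?_⟩
  have hc : Continuous (suppHom (d := d) Z) :=
    (suppHom (d := d) Z).toLinearMap.continuous_of_finiteDimensional
  have h1 := (hasSum_expTerm a).map (suppHom (d := d) Z) hc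
  have h2 : (suppHom (d := d) Z) ∘ expTerm a = expTerm (suppHom Z a) := funext fun m => by
    simp [expTerm]
  rw [h2] at h1
  exact h1.unique (hasSum_expTerm _)

/-- Across the cut `c`, the Gibbs operator at high temperature is close, in the sense of a small
relative error, to an operator of small Schmidt rank. -/
theorem exists_schmidtLE_one_add_mul_exp (hn : 1 ≤ n) (hk : 1 ≤ k) (hd : 1 ≤ d) (hη : 2 < η)
    (hh : IsPowerLawInteraction k g J η h)
    (hg : 0 ≤ g) (hJ0 : 0 ≤ J) (hgk : 8 * g * k ≤ 1)
    (hJ : J * (16 * Real.exp 1 * (η - 1) ^ 2 * (2 : ℝ) ^ (η - 2)) ≤ η - 2) (c W : ℕ) :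
    ∃ E : Op n d, ‖E‖ ≤ 6 * (1 / 2) ^ W ∧
      SchmidtLE (suppAlg d (leftSites n c)) (suppAlg d (leftSites n c)ᶜ)
        ((1 + E) * NormedSpace.exp (-hamiltonian h))
        ((W + 1) * ((2 : ℝ) ^ rankExponent k d η) ^ W) := by
  have : Nonempty (Config n d) := ⟨fun _ => ⟨0, hd⟩⟩
  have : NormOneClass (Op n d) := ⟨CStarRing.norm_one⟩
  set A := leftSites n c with hA
  have hcomm := suppAlg_commute (d := d) (disjoint_compl_right (a := A))
  obtain ⟨E, hE, hEq⟩ := exists_mul_exp_eq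
    (H₀ := ∑ Z, uncrossed c h Z) (V := fun r : Fin n => crossingSum c h r)
    (w := fun r => rangeWeight η r)
    (fun m => sum_weight_norm_adCoeff_le hη hh hg hJ0 hgk hJ c m) W
  refine ⟨E, hE, ?_⟩
  rw [hamiltonian_eq hn c h, ← hEq]
  -- the uncrossed part splits into a left part and a right part
  set HA : Op n d := ∑ Z with Z ⊆ A, h Z with hHA
  -- The empty set lies on both sides; the first condition keeps it from being counted twice.
  set HB : Op n d := ∑ Z with ¬ Z ⊆ A ∧ Z ⊆ Aᶜ, h Z with hHB
  have hsplit : ∑ Z, uncrossed c h Z = HA + HB := by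
    rw [hHA, hHB, sum_filter, sum_filter, ← sum_add_distrib]
    refine sum_congr rfl fun Z _ => ?_
    simp only [uncrossed, Crosses]
    by_cases h1 : Z ⊆ A <;> by_cases h2 : Z ⊆ Aᶜ <;> simp [h1, h2, ← hA]
  have hHAmem : HA ∈ suppAlg d A := sum_mem fun Z hZ =>
    suppAlg_mono (mem_filter.1 hZ).2 (hh.mem_suppAlg Z)
  have hHBmem : HB ∈ suppAlg d Aᶜ := sum_mem fun Z hZ =>
    suppAlg_mono (mem_filter.1 hZ).2.2 (hh.mem_suppAlg Z)
  have hexp : NormedSpace.exp (-(∑ Z, uncrossed c h Z)) =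
      NormedSpace.exp (-HA) * NormedSpace.exp (-HB) := by
    rw [hsplit, neg_add]
    exact Matrix.exp_add_of_commute _ _
      (Commute.neg_left (Commute.neg_right (hcomm _ hHAmem _ hHBmem)))
  rw [hexp]
  have hz : (0 : ℝ) < (2 : ℝ) ^ (-rankExponent k d η) := by positivity
  have hz1 : (2 : ℝ) ^ (-rankExponent k d η) ≤ 1 / 4 := by
    calc _ ≤ (2 : ℝ) ^ (-2 : ℝ) := Real.rpow_le_rpow_of_exponent_le (by norm_num)
          (neg_le_neg (two_le_rankExponent hd hη))
      _ = 1 / 4 := by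
          rw [Real.rpow_neg (by norm_num)]; norm_num
  have hT := schmidtLE_truncSum hcomm (w := fun r : Fin n => rangeWeight η r)
    (v := fun r m => adCoeff (∑ Z, uncrossed c h Z) (crossingSum c h r) m)
    (ρ := fun r => ((r : ℕ) : ℝ) ^ k * (d : ℝ) ^ (2 * k)) hz hz1
    (fun r m => by
      rw [hsplit]
      exact (schmidtLE_crossingSum hd hh c r).adCoeff hcomm hHAmem hHBmem m)
    (fun r => by positivity) (sum_rank_mul_weight_le hk hd hη n) W
  have := hT.mul hcomm (SchmidtLE.of_mem (exp_mem_suppAlg (neg_mem hHAmem))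
    (exp_mem_suppAlg (neg_mem hHBmem)))
  refine this.mono (le_of_eq ?_)
  rw [mul_one, Real.rpow_neg (by norm_num), inv_inv]

end Cut
-- The Hilbert-Schmidt norm
section Frobenius

variable {m n l : Type*} [Fintype m] [Fintype n] [Fintype l]

/-- A matrix as a vector of the space of its entries. -/
def entryVec : Matrix m n ℂ →ₗ[ℂ] EuclideanSpace ℂ (m × n) where
  toFun A := WithLp.toLp 2 fun p => A p.1 p.2
  map_add' _ _ := rfl
  map_smul' _ _ := rfl

/-- The Frobenius (Hilbert-Schmidt) norm. -/
def frob (A : Matrix m n ℂ) : ℝ := ‖entryVec A‖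

theorem frob_nonneg (A : Matrix m n ℂ) : 0 ≤ frob A := norm_nonneg _

theorem frob_sq (A : Matrix m n ℂ) : frob A ^ 2 = ∑ i, ∑ j, ‖A i j‖ ^ 2 := by
  rw [frob, EuclideanSpace.norm_sq_eq, Fintype.sum_prod_type]
  rfl

theorem frob_add_le (A B : Matrix m n ℂ) : frob (A + B) ≤ frob A + frob B := by
  rw [frob, map_add]
  exact norm_add_le _ _

theorem frob_smul (c : ℂ) (A : Matrix m n ℂ) : frob (c • A) = ‖c‖ * frob A := by
  rw [frob, map_smul, norm_smul, frob]

theorem frob_conjTranspose (A : Matrix m n ℂ) : frob A.conjTranspose = frob A := by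
  rw [← sq_eq_sq₀ (frob_nonneg _) (frob_nonneg _), frob_sq, frob_sq, sum_comm]
  simp

theorem frob_mul_le [DecidableEq n] (A : Matrix m n ℂ) (B : Matrix n l ℂ) :
    frob (A * B) ≤ ‖A‖ * frob B := by
  refine (sq_le_sq₀ (frob_nonneg _) (mul_nonneg (norm_nonneg _) (frob_nonneg _))).1 ?_
  have e1 : frob (A * B) ^ 2 = ∑ j, ∑ i, ‖(A * B) i j‖ ^ 2 := by rw [frob_sq, sum_comm]
  have e2 : frob B ^ 2 = ∑ j, ∑ i, ‖B i j‖ ^ 2 := by rw [frob_sq, sum_comm]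
  rw [mul_pow, e1, e2, mul_sum]
  refine sum_le_sum (N := ℝ) fun j _ => ?_
  have h := Matrix.l2_opNorm_mulVec A (WithLp.toLp 2 fun i => B i j)
  have h2 := pow_le_pow_left₀ (norm_nonneg _) h 2
  rw [mul_pow, EuclideanSpace.norm_sq_eq, EuclideanSpace.norm_sq_eq] at h2
  exact h2

theorem frob_mul_le' [DecidableEq n] [DecidableEq l] (A : Matrix m n ℂ) (B : Matrix n l ℂ) :
    frob (A * B) ≤ frob A * ‖B‖ := by
  rw [← frob_conjTranspose, Matrix.conjTranspose_mul]
  refine (frob_mul_le _ _).trans (le_of_eq ?_)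
  rw [Matrix.l2_opNorm_conjTranspose, frob_conjTranspose, mul_comm]

theorem inner_entryVec (A B : Matrix m n ℂ) :
    inner ℂ (entryVec A) (entryVec B) = (A.conjTranspose * B).trace := by
  rw [PiLp.inner_apply, Fintype.sum_prod_type, sum_comm, Matrix.trace]
  refine sum_congr rfl fun j _ => ?_
  rw [Matrix.diag_apply, Matrix.mul_apply]
  refine sum_congr rfl fun i _ => ?_
  rw [Matrix.conjTranspose_apply, mul_comm]
  rfl

theorem frob_sq_eq_trace (A : Matrix m n ℂ) :
    (A.conjTranspose * A).trace = ((frob A ^ 2 : ℝ) : ℂ) := by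
  rw [← inner_entryVec, inner_self_eq_norm_sq_to_K, frob]
  simp

theorem norm_trace_le (A B : Matrix m n ℂ) :
    ‖(A.conjTranspose * B).trace‖ ≤ frob A * frob B := by
  rw [← inner_entryVec]
  exact norm_inner_le_norm _ _

theorem frob_mul_unitary [DecidableEq n] (A : Matrix m n ℂ) {U : Matrix n n ℂ}
    (hU : U * U.conjTranspose = 1) : frob (A * U) = frob A := by
  have h : ((frob (A * U) ^ 2 : ℝ) : ℂ) = ((frob A ^ 2 : ℝ) : ℂ) := by
    rw [← frob_sq_eq_trace, ← frob_sq_eq_trace, Matrix.conjTranspose_mul, Matrix.trace_mul_comm,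
      Matrix.mul_assoc, ← Matrix.mul_assoc U, hU, Matrix.one_mul, Matrix.trace_mul_comm]
  have h' := Complex.ofReal_injective h
  exact (sq_eq_sq₀ (frob_nonneg _) (frob_nonneg _)).1 h'

end Frobenius

/-! ### A Hölder-type inequality and the stability of powers -/

section Hoelder

/-- A log-convex sequence is maximal at an end: at an interior first maximizer the left neighbour
would be strictly smaller, against the inequality. -/
theorem le_max_of_sq_le_mul {a : ℕ → ℝ} {s : ℕ} (h0 : ∀ j, 0 ≤ a j)
    (h : ∀ j, j + 2 ≤ s → a (j + 1) ^ 2 ≤ a j * a (j + 2)) {j : ℕ} (hj : j ≤ s) :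
    a j ≤ max (a 0) (a s) := by
  classical
  obtain ⟨i, hi, hmax⟩ := exists_max_image (range (s + 1)) a ⟨0, by simp⟩
  have hex : ∃ i, i ≤ s ∧ ∀ j ≤ s, a j ≤ a i :=
    ⟨i, by simpa [Nat.lt_succ_iff] using hi, fun j hj => hmax j (by simpa [Nat.lt_succ_iff])⟩
  obtain ⟨hi1, hi2⟩ := Nat.find_spec hex
  have hmin := fun m => Nat.find_min hex (m := m)
  generalize Nat.find hex = i at *
  refine (hi2 j hj).trans ?_
  rcases Nat.eq_zero_or_pos i with h1 | h1
  · rw [h1]; exact le_max_left _ _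
  rcases eq_or_lt_of_le hi1 with h2 | h2
  · rw [h2]; exact le_max_right _ _
  exfalso
  obtain ⟨p, rfl⟩ : ∃ p, i = p + 1 := ⟨i - 1, by omega⟩
  have hlt : a p < a (p + 1) := by
    by_contra hge
    exact hmin p (by omega) ⟨by omega, fun j hj => (hi2 j hj).trans (not_lt.1 hge)⟩
  have h3 := h p (by omega)
  have h4 := hi2 (p + 2) (by omega)
  nlinarith [h0 p, h0 (p + 1), h0 (p + 2)]

variable {m : Type*} [Fintype m] [DecidableEq m] {X : Matrix m m ℂ}

/-- The norms of X^j F X^{a+b-j} are log-convex in j: moving powers of X around the trace writes the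
square of one as an inner product of its two neighbours, and Cauchy-Schwarz applies. -/
theorem frob_pow_mul_pow_le (hX : X.IsHermitian) (F : Matrix m m ℂ) (a b : ℕ) :
    frob (X ^ a * F * X ^ b) ≤ max (frob (F * X ^ (a + b))) (frob (X ^ (a + b) * F)) := by
  have key := le_max_of_sq_le_mul (a := fun j => frob (X ^ j * F * X ^ (a + b - j)))
    (s := a + b) (fun _ => frob_nonneg _) (fun j hj => ?_) (Nat.le_add_right a b)
  · simpa using key
  obtain ⟨c, hc⟩ : ∃ c, a + b = j + 2 + c := ⟨a + b - (j + 2), by omega⟩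
  have e1 : a + b - (j + 1) = c + 1 := by omega
  have e2 : a + b - j = c + 2 := by omega
  have e3 : a + b - (j + 2) = c := by omega
  rw [e1, e2, e3]
  have hp : ∀ i, (X ^ i).conjTranspose = X ^ i := fun i => by
    rw [Matrix.conjTranspose_pow, hX]
  have h1 : ((frob (X ^ (j + 1) * F * X ^ (c + 1)) ^ 2 : ℝ) : ℂ) =
      ((X ^ j * F * X ^ (c + 2)).conjTranspose * (X ^ (j + 2) * F * X ^ c)).trace := by
    rw [← frob_sq_eq_trace]
    simp only [Matrix.conjTranspose_mul, hp]
    have hcyc : ∀ (p q u v : ℕ) (G G' : Matrix m m ℂ),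
        (X ^ p * (G * X ^ q) * (X ^ u * G' * X ^ v)).trace =
          (X ^ (v + p) * G * X ^ (q + u) * G').trace := fun p q u v G G' => by
      rw [← Matrix.mul_assoc, Matrix.trace_mul_comm, pow_add, pow_add]
      simp only [Matrix.mul_assoc]
    rw [hcyc, hcyc, show c + 1 + (c + 1) = c + (c + 2) by ring,
      show j + 1 + (j + 1) = j + (j + 2) by ring]
  have h2 := norm_trace_le (X ^ j * F * X ^ (c + 2)) (X ^ (j + 2) * F * X ^ c)
  rw [← h1, Complex.norm_real, Real.norm_of_nonneg (sq_nonneg _)] at h2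
  exact h2

/-- Induction on the number of letters. `frob_pow_mul_pow_le` moves the two outer powers of X to one
side, which exposes a letter at the other end; it is stripped off in operator norm, and the total
power of X is preserved. -/
theorem frob_word_le (hX : X.IsHermitian) (r : ℕ) :
    ∀ (l : List (Matrix m m ℂ × ℕ)), l.length = r → ∀ a : ℕ,
      frob (X ^ a * (l.map fun p => p.1 * X ^ p.2).prod) ≤
        (l.map fun p => ‖p.1‖).prod * frob (X ^ (a + (l.map Prod.snd).sum)) := by
  induction r with
  | zero =>
    intro l hl a
    rw [List.length_eq_zero_iff] at hl
    subst hl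
    simp
  | succ r ih =>
    intro l hl a
    have hnn : ∀ l : List (Matrix m m ℂ × ℕ), 0 ≤ (l.map fun p => ‖p.1‖).prod := fun l =>
      List.prod_nonneg fun x hx => by
        obtain ⟨p, -, rfl⟩ := List.mem_map.1 hx
        exact norm_nonneg _
    rcases List.eq_nil_or_concat l with rfl | ⟨l', ⟨E, b⟩, rfl⟩
    · simp at hl
    rw [List.concat_eq_append] at hl ⊢
    have hl' : l'.length = r := by simpa using hl
    simp only [List.map_append, List.map_cons, List.map_nil, List.prod_append, List.prod_cons,
      List.prod_nil, mul_one, List.sum_append, List.sum_cons, List.sum_nil, add_zero]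
    set Q := (l'.map fun p => p.1 * X ^ p.2).prod with hQ
    have h1 : frob (X ^ a * (Q * (E * X ^ b))) ≤
        max (frob ((Q * E) * X ^ (a + b))) (frob (X ^ (a + b) * (Q * E))) := by
      simpa only [mul_assoc] using frob_pow_mul_pow_le hX (Q * E) a b
    refine h1.trans (max_le ?_ ?_)
    · rcases l' with _ | ⟨⟨E₁, b₁⟩, t⟩
      · simp only [List.map_nil, List.prod_nil] at hQ
        rw [hQ]
        simpa [add_comm] using frob_mul_le E (X ^ (a + b))
      · have h2 := ih (t ++ [(E, a + b)]) (by simpa using hl') b₁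
        simp only [List.map_append, List.map_cons, List.map_nil, List.prod_append, List.prod_cons,
          List.prod_nil, mul_one, List.sum_append, List.sum_cons, List.sum_nil, add_zero] at h2
        have h3 : Q * E * X ^ (a + b) =
            E₁ * (X ^ b₁ * ((t.map fun p => p.1 * X ^ p.2).prod * (E * X ^ (a + b)))) := by
          rw [hQ]
          simp only [List.map_cons, List.prod_cons, mul_assoc]
        rw [h3]
        refine (frob_mul_le _ _).trans
          ((mul_le_mul_of_nonneg_left h2 (norm_nonneg _)).trans (le_of_eq ?_))
        simp only [List.map_cons, List.prod_cons, List.sum_cons]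
        rw [show b₁ + ((t.map Prod.snd).sum + (a + b)) = a + (b₁ + (t.map Prod.snd).sum + b) by ring]
        ring
    · rw [← mul_assoc]
      refine (frob_mul_le' _ _).trans
        ((mul_le_mul_of_nonneg_right (ih l' hl' (a + b)) (norm_nonneg _)).trans (le_of_eq ?_))
      rw [show a + b + (l'.map Prod.snd).sum = a + ((l'.map Prod.snd).sum + b) by ring]
      ring

/-- Telescoping: the factors (1 + E) X are replaced by X one at a time, from the right. The extra
X^b holds the factors already replaced. -/
theorem frob_pow_sub_pow_le_aux [Nonempty m] (hX : X.IsHermitian) {E : Matrix m m ℂ} {δ : ℝ}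
    (hE : ‖E‖ ≤ δ) (j : ℕ) : ∀ b : ℕ,
    frob (((1 + E) * X) ^ j * X ^ b - X ^ (j + b)) ≤ ((1 + δ) ^ j - 1) * frob (X ^ (j + b)) := by
  have hδ : 0 ≤ δ := (norm_nonneg E).trans hE
  induction j with
  | zero => intro b; simp [frob]
  | succ j ih =>
    intro b
    have h1 : ((1 + E) * X) ^ (j + 1) * X ^ b - X ^ (j + 1 + b) =
        ((1 + E) * X) ^ j * (E * X ^ (b + 1)) +
          (((1 + E) * X) ^ j * X ^ (b + 1) - X ^ (j + (b + 1))) := by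
      rw [show j + 1 + b = j + (b + 1) by ring, pow_succ, pow_succ' X b]
      noncomm_ring
    have h2 : frob (((1 + E) * X) ^ j * (E * X ^ (b + 1))) ≤
        (1 + δ) ^ j * δ * frob (X ^ (j + (b + 1))) := by
      have h3 := frob_word_le hX (j + 1) (List.replicate j (1 + E, 1) ++ [(E, b + 1)])
        (by simp) 0
      simp only [List.map_append, List.map_replicate, List.map_cons, List.map_nil,
        List.prod_append, List.prod_replicate, List.prod_cons, List.prod_nil, mul_one,
        List.sum_append, List.sum_replicate, List.sum_cons, List.sum_nil, add_zero, pow_one,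
        pow_zero, one_mul, zero_add, smul_eq_mul] at h3
      refine h3.trans ?_
      have h4 : ‖1 + E‖ ≤ 1 + δ := by
        refine (norm_add_le _ _).trans ?_
        rw [CStarRing.norm_one]
        linarith
      have := frob_nonneg (X ^ (j + (b + 1)))
      gcongr
    rw [h1, show j + 1 + b = j + (b + 1) by ring]
    refine (frob_add_le _ _).trans ((add_le_add h2 (ih (b + 1))).trans (le_of_eq ?_))
    rw [pow_succ]
    ring

theorem frob_pow_sub_pow_le [Nonempty m] (hX : X.IsHermitian) {E : Matrix m m ℂ} {δ : ℝ}
    (hE : ‖E‖ ≤ δ) (j : ℕ) :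
    frob (((1 + E) * X) ^ j - X ^ j) ≤ ((1 + δ) ^ j - 1) * frob (X ^ j) := by
  simpa using frob_pow_sub_pow_le_aux hX hE j 0

end Hoelder
-- Partial isometries onto column spaces
section Isometry

variable {X : Type*} [Fintype X] [DecidableEq X] {D : ℕ}

/-- A partial isometry onto a space that contains the columns of `f`. -/
theorem exists_partialIsometry (f : Matrix X (Fin D) ℂ) :
    ∃ U : Matrix X (Fin D) ℂ, ‖U‖ ≤ 1 ∧ ‖1 - U * U.conjTranspose‖ ≤ 1 ∧
      U * U.conjTranspose * f = f := by
  let col : Fin D → EuclideanSpace ℂ X := fun j => WithLp.toLp 2 fun x => f x j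
  set S : Submodule ℂ (EuclideanSpace ℂ X) := Submodule.span ℂ (Set.range col) with hS
  have hdim : Module.finrank ℂ S ≤ D := by
    have h := finrank_range_le_card (R := ℂ) col
    rwa [Fintype.card_fin] at h
  let b := stdOrthonormalBasis ℂ S
  let e : Fin (Module.finrank ℂ S) ↪ Fin D := Fin.castLEEmb hdim
  -- An orthonormal basis of the column space, padded with zero columns up to D.
  let u : Fin D → EuclideanSpace ℂ X := fun j =>
    if h : (j : ℕ) < Module.finrank ℂ S then ((b ⟨j, h⟩ : S) : EuclideanSpace ℂ X) else 0
  let U : Matrix X (Fin D) ℂ := Matrix.of fun x j => u j x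
  have hUU : U.conjTranspose * U =
      Matrix.diagonal fun j : Fin D => if (j : ℕ) < Module.finrank ℂ S then (1 : ℂ) else 0 := by
    ext i j
    have h1 : (U.conjTranspose * U) i j = inner ℂ (u i) (u j) := by
      rw [Matrix.mul_apply, PiLp.inner_apply]
      refine sum_congr rfl fun x _ => ?_
      rw [Matrix.conjTranspose_apply, mul_comm]
      rfl
    rw [h1, Matrix.diagonal_apply]
    by_cases hi : (i : ℕ) < Module.finrank ℂ S
    · by_cases hj : (j : ℕ) < Module.finrank ℂ S
      · simp only [u, dif_pos hi, dif_pos hj, if_pos hi]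
        rw [← Submodule.coe_inner, orthonormal_iff_ite.1 b.orthonormal]
        simp [Fin.ext_iff]
      · have : i ≠ j := fun h => hj (h ▸ hi)
        simp [u, dif_neg hj, this]
    · simp [u, dif_neg hi, hi]
  have hU1 : ‖U‖ ≤ 1 := by
    have h1 := Matrix.l2_opNorm_conjTranspose_mul_self U
    rw [hUU, Matrix.l2_opNorm_diagonal] at h1
    have h2 : ‖fun j : Fin D => if (j : ℕ) < Module.finrank ℂ S then (1 : ℂ) else 0‖ ≤ 1 := by
      refine (pi_norm_le_iff_of_nonneg zero_le_one).2 fun j => ?_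
      split_ifs <;> simp
    rw [h1] at h2
    nlinarith [norm_nonneg U]
  have hUUU : U * U.conjTranspose * U = U := by
    rw [Matrix.mul_assoc, hUU]
    ext x j
    rw [Matrix.mul_diagonal]
    by_cases hj : (j : ℕ) < Module.finrank ℂ S
    · simp [hj]
    · simp [hj, U, u]
  refine ⟨U, hU1, ?_, ?_⟩
  · set Q : Matrix X X ℂ := 1 - U * U.conjTranspose with hQ
    have hQQ : Q.conjTranspose * Q = Q := by
      have h1 : Q.conjTranspose = Q := by simp [hQ]
      rw [h1]
      have h2 : U * U.conjTranspose * (U * U.conjTranspose) = U * U.conjTranspose := by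
        rw [← Matrix.mul_assoc, hUUU]
      rw [hQ, Matrix.sub_mul, Matrix.mul_sub, Matrix.mul_sub, h2]
      simp
    have h1 := Matrix.l2_opNorm_conjTranspose_mul_self Q
    rw [hQQ] at h1
    by_contra hlt
    push Not at hlt
    nlinarith
  · ext x j
    have hmem : col j ∈ S := Submodule.subset_span ⟨j, rfl⟩
    have h1 := b.sum_repr' ⟨col j, hmem⟩
    have h2 := congrArg (fun v : S => (v : EuclideanSpace ℂ X) x) h1
    simp only [Submodule.coe_sum, Submodule.coe_smul] at h2
    have h3 : f x j = (col j) x := rfl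
    rw [Matrix.mul_assoc, Matrix.mul_apply, h3, ← h2]
    have h4 : ∀ i, (U.conjTranspose * f) i j = inner ℂ (u i) (col j) := fun i => by
      rw [Matrix.mul_apply, PiLp.inner_apply]
      refine sum_congr rfl fun x _ => ?_
      rw [Matrix.conjTranspose_apply, mul_comm]
      rfl
    have h5 : ∀ i, i ∉ Set.range e → U x i * (U.conjTranspose * f) i j = 0 := fun i hi => by
      have : ¬ (i : ℕ) < Module.finrank ℂ S := fun h => hi ⟨⟨i, h⟩, Fin.ext rfl⟩
      simp [U, u, this]
    rw [← Fintype.sum_of_injective e e.injective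
      (fun i => inner ℂ ((b i : S) : EuclideanSpace ℂ X) (col j) * ((b i : S) : EuclideanSpace ℂ X) x)
      (fun i => U x i * (U.conjTranspose * f) i j) h5]
    · rw [WithLp.ofLp_sum, Finset.sum_apply]
      rfl
    · intro i
      have hi : ((e i : Fin D) : ℕ) < Module.finrank ℂ S := i.2
      rw [h4]
      simp only [U, Matrix.of_apply, u, dif_pos hi]
      rw [mul_comm]
      rfl

end Isometry

/-! ### From approximations at every cut to a matrix product state -/

section Train

variable {P : Type*} [Fintype P] {D n : ℕ}

/-- `Φ` has Schmidt rank at most `D` across the cut after the first `j` sites, the row index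
being counted to the left part. -/
def CutRank {A : Type*} (D j : ℕ) (Φ : Matrix A (Fin n → P) ℂ) : Prop :=
  ∃ (f : A → (Fin n → P) → Fin D → ℂ) (g : Fin D → (Fin n → P) → ℂ),
    (∀ a σ τ b, (∀ i : Fin n, (i : ℕ) < j → σ i = τ i) → f a σ b = f a τ b) ∧
    (∀ σ τ b, (∀ i : Fin n, j ≤ (i : ℕ) → σ i = τ i) → g b σ = g b τ) ∧
    ∀ a σ, Φ a σ = ∑ b, f a σ b * g b σ

/-- Move the first site into the row index. -/
def peel (T : Matrix (Fin D) (Fin (n + 1) → P) ℂ) : Matrix (Fin D × P) (Fin n → P) ℂ :=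
  Matrix.of fun p σ => T p.1 (Fin.cons p.2 σ)

theorem frob_peel (T : Matrix (Fin D) (Fin (n + 1) → P) ℂ) : frob (peel T) = frob T := by
  rw [← sq_eq_sq₀ (frob_nonneg _) (frob_nonneg _), frob_sq, frob_sq, Fintype.sum_prod_type]
  refine sum_congr rfl fun a _ => ?_
  rw [← (Fin.consEquiv fun _ : Fin (n + 1) => P).sum_comp fun σ => ‖T a σ‖ ^ 2,
    Fintype.sum_prod_type]
  rfl

omit [Fintype P] in
theorem peel_sub (T T' : Matrix (Fin D) (Fin (n + 1) → P) ℂ) :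
    peel (T - T') = peel T - peel T' := rfl

omit [Fintype P] in
theorem CutRank.peel_one [Nonempty P] {Φ : Matrix (Fin D) (Fin (n + 1) → P) ℂ}
    (h : CutRank D 1 Φ) : ∃ (f : Matrix (Fin D × P) (Fin D) ℂ) (g : Matrix (Fin D) (Fin n → P) ℂ),
      peel Φ = f * g := by
  obtain ⟨f, g, hf, hg, hΦ⟩ := h
  -- A filler: the right factor does not depend on the first site.
  let s₀ : P := Classical.arbitrary P
  refine ⟨Matrix.of fun p b => f p.1 (fun _ => p.2) b, Matrix.of fun b σ => g b (Fin.cons s₀ σ), ?_⟩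
  ext ⟨a, s⟩ σ
  rw [Matrix.mul_apply]
  refine (hΦ a (Fin.cons s σ)).trans (sum_congr rfl fun b _ => ?_)
  rw [Matrix.of_apply, Matrix.of_apply]
  congr 1
  · refine hf _ _ _ _ fun i hi => ?_
    obtain rfl : i = 0 := Fin.ext (by simpa using hi)
    rfl
  · refine hg _ _ _ fun i hi => ?_
    obtain ⟨i', rfl⟩ := Fin.exists_succ_eq.2 (show i ≠ 0 by rintro rfl; simp at hi)
    rfl

/-- The projection at one site acts left of all later cuts, so it does not raise their ranks. -/
theorem CutRank.mul_peel [Nonempty P] {j : ℕ} {Φ : Matrix (Fin D) (Fin (n + 1) → P) ℂ}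
    (h : CutRank D (j + 1) Φ) (U : Matrix (Fin D) (Fin D × P) ℂ) : CutRank D j (U * peel Φ) := by
  obtain ⟨f, g, hf, hg, hΦ⟩ := h
  let s₀ : P := Classical.arbitrary P
  refine ⟨fun a σ b => ∑ p, U a p * f p.1 (Fin.cons p.2 σ) b, fun b σ => g b (Fin.cons s₀ σ),
    fun a σ τ b hστ => ?_, fun σ τ b hστ => ?_, fun a σ => ?_⟩
  · refine sum_congr rfl fun p _ => ?_
    congr 1
    refine hf _ _ _ _ fun i => ?_
    refine Fin.cases (fun _ => rfl) (fun i hi => ?_) i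
    exact hστ i (by simpa using hi)
  · refine hg _ _ _ fun i => ?_
    refine Fin.cases (fun _ => rfl) (fun i hi => ?_) i
    exact hστ i (by simpa using hi)
  · rw [Matrix.mul_apply]
    simp only [sum_mul]
    rw [sum_comm]
    refine sum_congr rfl fun p _ => ?_
    have h1 : peel Φ p σ = ∑ b, f p.1 (Fin.cons p.2 σ) b * g b (Fin.cons s₀ σ) := by
      refine (hΦ p.1 (Fin.cons p.2 σ)).trans (sum_congr rfl fun b _ => ?_)
      congr 1
      refine hg _ _ _ fun i => ?_
      refine Fin.cases (fun hi => ?_) (fun i _ => rfl) i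
      simp at hi
    rw [h1, mul_sum]
    exact sum_congr rfl fun b _ => (mul_assoc _ _ _).symm

/-- The tensor with row index generated by the matrices `M`. -/
def train [NeZero D] (M : Fin n → P → Matrix (Fin D) (Fin D) ℂ) :
    Matrix (Fin D) (Fin n → P) ℂ :=
  Matrix.of fun a σ => (List.ofFn fun i => M i (σ i)).prod a 0

omit [Fintype P] in
theorem peel_train [NeZero D] (M : Fin (n + 1) → P → Matrix (Fin D) (Fin D) ℂ) :
    peel (train M) =
      (Matrix.of fun p b => M 0 p.2 p.1 b : Matrix (Fin D × P) (Fin D) ℂ) *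
        train fun i => M i.succ := by
  ext ⟨a, s⟩ σ
  change (List.ofFn fun i => M i ((Fin.cons s σ : Fin (n + 1) → P) i)).prod a 0 = _
  rw [List.ofFn_succ, List.prod_cons, Matrix.mul_apply, Matrix.mul_apply]
  rfl

/-- Let U span the columns of the approximant Φ at the first cut. As 1 - U U* kills Φ, projecting T
costs at most ‖T - Φ‖₂. What remains, U* T, is approximated at later cuts as well as T was, since U*
is a contraction. So the errors add up. -/
theorem exists_train_frob_le [NeZero D] [Nonempty P] (n : ℕ) :
    ∀ (T : Matrix (Fin D) (Fin (n + 1) → P) ℂ) (ε : ℕ → ℝ),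
      (∀ j, 1 ≤ j → j ≤ n → ∃ Φ : Matrix (Fin D) (Fin (n + 1) → P) ℂ,
        CutRank D j Φ ∧ frob (T - Φ) ≤ ε j) →
      ∃ M : Fin (n + 1) → P → Matrix (Fin D) (Fin D) ℂ,
        frob (T - train M) ≤ ∑ j ∈ range n, ε (j + 1) := by
  classical
  induction n with
  | zero =>
    intro T ε _
    refine ⟨fun _ s => Matrix.of fun a b => if b = 0 then T a (fun _ => s) else 0, ?_⟩
    have : T = train fun (_ : Fin 1) s => Matrix.of fun a b =>
        if b = 0 then T a (fun _ => s) else 0 := by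
      ext a σ
      have hσ : σ = fun _ => σ 0 := funext fun i => by rw [Fin.fin_one_eq_zero i]
      simp only [train, Matrix.of_apply, List.ofFn_succ, List.ofFn_zero, List.prod_cons,
        List.prod_nil, mul_one, if_true]
      rw [← hσ]
    rw [← this]
    simp [frob]
  | succ n ih =>
    intro T ε hT
    obtain ⟨Φ, hΦ, hΦε⟩ := hT 1 le_rfl (by omega)
    obtain ⟨f, g, hfg⟩ := hΦ.peel_one
    obtain ⟨U, hU1, hU2, hU3⟩ := exists_partialIsometry f
    obtain ⟨M', hM'⟩ := ih (U.conjTranspose * peel T) (fun j => ε (j + 1)) (by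
      intro j hj1 hjn
      obtain ⟨Ψ, hΨ, hΨε⟩ := hT (j + 1) (by omega) (by omega)
      refine ⟨U.conjTranspose * peel Ψ, hΨ.mul_peel _, ?_⟩
      rw [← Matrix.mul_sub, ← peel_sub]
      refine (frob_mul_le _ _).trans ?_
      rw [Matrix.l2_opNorm_conjTranspose, frob_peel]
      refine le_trans ?_ hΨε
      exact mul_le_of_le_one_left (frob_nonneg _) hU1)
    refine ⟨Fin.cons (fun s => Matrix.of fun a b => U (a, s) b) M', ?_⟩
    have h1 : peel (train (Fin.cons (fun s => Matrix.of fun a b => U (a, s) b) M' :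
        Fin (n + 2) → P → Matrix (Fin D) (Fin D) ℂ)) = U * train M' := by
      rw [peel_train]
      rfl
    have h2 : peel T - U * train M' = (1 - U * U.conjTranspose) * (peel T - peel Φ) +
        U * (U.conjTranspose * peel T - train M') := by
      have h3 : (1 - U * U.conjTranspose) * peel Φ = 0 := by
        rw [hfg, ← Matrix.mul_assoc, Matrix.sub_mul, Matrix.one_mul, hU3, sub_self,
          Matrix.zero_mul]
      rw [Matrix.mul_sub _ (peel T), h3, Matrix.sub_mul, Matrix.mul_sub, Matrix.mul_assoc]
      simp
    rw [← frob_peel, peel_sub, h1, h2, sum_range_succ', add_comm (∑ j ∈ range n, _)]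
    refine (frob_add_le _ _).trans (add_le_add ?_ ?_)
    · refine (frob_mul_le _ _).trans ?_
      rw [← peel_sub, frob_peel]
      exact (mul_le_of_le_one_left (frob_nonneg _) hU2).trans hΦε
    · refine (frob_mul_le _ _).trans ?_
      exact (mul_le_of_le_one_left (frob_nonneg _) hU1).trans hM'

/-- A vector that is close, for every cut, to a vector of Schmidt rank at most `D` is close to a
matrix product state of bond dimension `D`. -/
theorem exists_mps_norm_sub_le {P : Type} [Fintype P] [Nonempty P] (hn : 1 ≤ n) (hD : 1 ≤ D)
    (ψ : EuclideanSpace ℂ (Fin n → P)) (ε : ℝ)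
    (hψ : ∀ j : ℕ, ∃ φ : EuclideanSpace ℂ (Fin n → P),
      CutRank D j (Matrix.of fun (_ : Unit) σ => φ σ) ∧ ‖ψ - φ‖ ≤ ε) :
    ∃ M : Fin n → P → Matrix (Fin D) (Fin D) ℂ, ‖ψ - mps M‖ ≤ n * ε := by
  obtain ⟨n, rfl⟩ : ∃ m, n = m + 1 := ⟨n - 1, by omega⟩
  have : NeZero D := ⟨by omega⟩
  let row : EuclideanSpace ℂ (Fin (n + 1) → P) → Matrix (Fin D) (Fin (n + 1) → P) ℂ := fun φ =>
    Matrix.of fun a σ => if a = 0 then φ σ else 0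
  have hrow : ∀ φ, frob (row φ) = ‖φ‖ := fun φ => by
    rw [← sq_eq_sq₀ (frob_nonneg _) (norm_nonneg _), frob_sq, EuclideanSpace.norm_sq_eq,
      sum_eq_single 0 _ (by simp)]
    · simp [row]
    · intro a _ ha
      simp [row, ha]
  have hrow_sub : ∀ φ φ', row φ - row φ' = row (φ - φ') := fun φ φ' => by
    ext a σ
    by_cases ha : a = 0 <;> simp [row, ha]
  obtain ⟨M, hM⟩ := exists_train_frob_le n (row ψ) (fun _ => ε) fun j _ _ => by
    obtain ⟨φ, ⟨f, g, hf, hg, hφ⟩, hε⟩ := hψ j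
    refine ⟨row φ, ⟨fun a σ b => if a = 0 then f () σ b else 0, g, fun a σ τ b h => ?_, hg,
      fun a σ => ?_⟩, ?_⟩
    · simp only [hf () σ τ b h]
    · by_cases ha : a = 0
      · simpa [row, ha] using hφ () σ
      · simp [row, ha]
    · rwa [hrow_sub, hrow]
  have hε : 0 ≤ ε := by
    obtain ⟨φ, -, h⟩ := hψ 0
    exact (norm_nonneg _).trans h
  -- Keeping only row 0 of the first matrix turns the trace into the (0, 0) entry of the product.
  refine ⟨Fin.cons (fun s => Matrix.of fun a b => if a = 0 then M 0 s 0 b else 0)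
    fun i => M i.succ, ?_⟩
  have hmps : ∀ σ, mps (Fin.cons (fun s => Matrix.of fun a b => if a = 0 then M 0 s 0 b else 0)
      (fun i => M i.succ) : Fin (n + 1) → P → Matrix (Fin D) (Fin D) ℂ) σ = train M 0 σ := by
    intro σ
    simp only [mps, train, Matrix.of_apply, List.ofFn_succ, List.prod_cons, Fin.cons_zero,
      Fin.cons_succ, Matrix.trace, Matrix.diag_apply]
    rw [sum_eq_single 0 _ (by simp)]
    · simp [Matrix.mul_apply]
    · intro a _ ha
      simp [Matrix.mul_apply, ha]
  have h1 : ‖ψ - mps (Fin.cons (fun s => Matrix.of fun a b => if a = 0 then M 0 s 0 b else 0)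
      (fun i => M i.succ) : Fin (n + 1) → P → Matrix (Fin D) (Fin D) ℂ)‖ ≤
        frob (row ψ - train M) := by
    rw [← sq_le_sq₀ (norm_nonneg _) (frob_nonneg _), frob_sq, EuclideanSpace.norm_sq_eq]
    refine le_trans (le_of_eq ?_) (single_le_sum
      (f := fun a => ∑ σ, ‖(row ψ - train M) a σ‖ ^ 2)
      (fun a _ => sum_nonneg fun σ _ => sq_nonneg _) (mem_univ (0 : Fin D)))
    refine sum_congr rfl fun σ _ => ?_
    rw [PiLp.sub_apply, hmps, Matrix.sub_apply]
    simp [row]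
  refine h1.trans (hM.trans ?_)
  rw [sum_const, card_range, nsmul_eq_mul]
  push_cast
  linarith

end Train
-- The purified Gibbs state as an operator
section Purification

variable {n d : ℕ}

/-- The transpose of the product operator `⨂ W i`. -/
def siteProd (W : Fin n → Matrix (Fin d) (Fin d) ℂ) : Op n d :=
  Matrix.of fun s t => ∏ i, W i (t i) (s i)

theorem siteProd_mul_conjTranspose {W : Fin n → Matrix (Fin d) (Fin d) ℂ}
    (hW : ∀ i, (W i).conjTranspose * W i = 1) :
    siteProd W * (siteProd W).conjTranspose = 1 := by
  ext s t
  have h1 : ∀ i, ∑ a, W i a (s i) * star (W i a (t i)) = if s i = t i then 1 else 0 := fun i => by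
    have h2 := congrFun (congrFun (hW i) (t i)) (s i)
    rw [Matrix.mul_apply, Matrix.one_apply] at h2
    simp only [eq_comm (a := t i)] at h2
    rw [← h2]
    exact sum_congr rfl fun a _ => by rw [Matrix.conjTranspose_apply, mul_comm]
  have h3 : (siteProd W * (siteProd W).conjTranspose) s t =
      ∑ u : Config n d, ∏ i, W i (u i) (s i) * star (W i (u i) (t i)) := by
    rw [Matrix.mul_apply]
    refine sum_congr rfl fun u _ => ?_
    rw [Matrix.conjTranspose_apply, siteProd, Matrix.of_apply, Matrix.of_apply, star_prod,
      ← prod_mul_distrib]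
  rw [h3, ← Fintype.piFinset_univ,
    ← prod_univ_sum (fun _ => univ) fun i a => W i a (s i) * star (W i a (t i))]
  simp only [h1, Matrix.one_apply, funext_iff]
  rw [prod_ite_zero]
  simp

theorem schmidtLE_siteProd (A : Finset (Fin n)) (W : Fin n → Matrix (Fin d) (Fin d) ℂ) :
    SchmidtLE (suppAlg d A) (suppAlg d Aᶜ) (siteProd W) 1 := by
  let p : (Z : Finset (Fin n)) → Matrix (Z → Fin d) (Z → Fin d) ℂ := fun Z =>
    Matrix.of fun s t => ∏ i : Z, W i (t i) (s i)
  have h : siteProd W = suppHom A (p A) * suppHom Aᶜ (p Aᶜ) := by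
    ext s t
    rw [suppHom_mul_apply disjoint_compl_right, if_pos]
    · simp only [p, Matrix.of_apply, siteProd]
      rw [prod_coe_sort A fun i => W i (t i) (s i), prod_coe_sort Aᶜ fun i => W i (t i) (s i),
        prod_mul_prod_compl]
    · intro i h1 h2
      exact absurd (mem_compl.2 h1) h2
  rw [h]
  exact SchmidtLE.of_mem ⟨_, rfl⟩ ⟨_, rfl⟩

/-- An operator as a vector of the doubled chain. -/
def chainVec (A : Op n d) : EuclideanSpace ℂ (Fin n → Fin d × Fin d) :=
  WithLp.toLp 2 fun σ => A (fun i => (σ i).1) (fun i => (σ i).2)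

theorem norm_chainVec (A : Op n d) : ‖chainVec A‖ = frob A := by
  rw [← sq_eq_sq₀ (norm_nonneg _) (frob_nonneg _), frob_sq, EuclideanSpace.norm_sq_eq,
    ← (Equiv.arrowProdEquivProdArrow (Fin n) (fun _ => Fin d) (fun _ => Fin d)).symm.sum_comp,
    Fintype.sum_prod_type]
  rfl

theorem chainVec_sub (A B : Op n d) : chainVec (A - B) = chainVec A - chainVec B := rfl

/-- Since site i carries the i-th qudits of both chains, an operator product decomposition across
the cut is a Schmidt decomposition of the vector. -/
theorem SchmidtLE.cutRank {c D : ℕ} {A : Op n d} {b : ℝ}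
    (h : SchmidtLE (suppAlg d (leftSites n c)) (suppAlg d (leftSites n c)ᶜ) A b) (hb : b ≤ D) :
    CutRank D c (Matrix.of fun (_ : Unit) σ => chainVec A σ) := by
  obtain ⟨m, hm, l, r, hl, hr, rfl⟩ := h
  have hmD : m ≤ D := by exact_mod_cast hm.trans hb
  choose a ha using hl
  choose a' ha' using hr
  refine ⟨fun _ σ j => if hj : (j : ℕ) < m then
      a ⟨j, hj⟩ (fun i => (σ i).1) (fun i => (σ i).2) else 0,
    fun j σ => if hj : (j : ℕ) < m then
      a' ⟨j, hj⟩ (fun i => (σ i).1) (fun i => (σ i).2) else 0, ?_, ?_, ?_⟩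
  · intro _ σ τ j hστ
    have : ∀ i : leftSites n c, σ i = τ i := fun i => hστ i (mem_leftSites.1 i.2)
    simp only [this]
  · intro σ τ j hστ
    have : ∀ i : ((leftSites n c)ᶜ : Finset (Fin n)), σ i = τ i := fun i => hστ i (by
      have := mem_compl.1 i.2
      rw [mem_leftSites] at this
      omega)
    simp only [this]
  · intro _ σ
    have h1 : (Matrix.of fun (_ : Unit) σ => chainVec (∑ i, l i * r i) σ) () σ =
        ∑ i, a i (fun i => (σ i).1) (fun i => (σ i).2) *
          a' i (fun i => (σ i).1) (fun i => (σ i).2) := by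
      rw [Matrix.of_apply, chainVec]
      simp only [Matrix.sum_apply]
      refine sum_congr rfl fun i _ => ?_
      rw [← ha, ← ha']
      refine (suppHom_mul_apply disjoint_compl_right _ _ _ _).trans (if_pos ?_)
      intro i h1 h2
      exact absurd (mem_compl.2 h1) h2
    refine h1.trans ?_
    refine Fintype.sum_of_injective (Fin.castLE hmD) (Fin.castLE_injective hmD) _ _ ?_ ?_
    · intro j hj
      have : ¬ (j : ℕ) < m := fun h => hj ⟨⟨j, h⟩, Fin.ext rfl⟩
      simp [this]
    · intro i
      simp

theorem sum_mul_star_basis (e : OrthonormalBasis (Config n d) ℂ (ChainSpace n d))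
    (u v : Config n d) : ∑ j, e j u * star (e j v) = if u = v then 1 else 0 := by
  have h := e.sum_inner_mul_inner (EuclideanSpace.single u (1 : ℂ)) (EuclideanSpace.single v 1)
  simp only [EuclideanSpace.inner_single_left, EuclideanSpace.inner_single_right, map_one,
    one_mul] at h
  rw [PiLp.single_apply] at h
  refine h.trans ?_
  by_cases huv : u = v
  · simp [huv]
  · simp [huv, Ne.symm huv]

/-- Completeness of e removes the sum over j, and with it the choice of basis; only the one-site
unitaries remain. -/
theorem purifiedGibbs_eq (H : Op n d) (β : ℝ)
    (e e' : OrthonormalBasis (Config n d) ℂ (ChainSpace n d))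
    {W : Fin n → Matrix (Fin d) (Fin d) ℂ}
    (hW : ∀ j t : Config n d, e' j t = ∑ s : Config n d, (∏ i, W i (t i) (s i)) * star (e j s)) :
    purifiedGibbs H β e e' = (((Real.sqrt (partitionFunction H β) : ℝ) : ℂ)⁻¹) •
      chainVec (NormedSpace.exp ((-(β / 2 : ℂ)) • H) * siteProd W) := by
  ext σ
  rw [purifiedGibbs, PiLp.smul_apply, smul_eq_mul]
  change _ * _ = _ * _
  congr 1
  set K := NormedSpace.exp ((-(β / 2 : ℂ)) • H)
  set s : Config n d := fun i => (σ i).1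
  set t : Config n d := fun i => (σ i).2
  calc ∑ j, K.mulVec (fun s => e j s) s * e' j t
      = ∑ j, ∑ u, ∑ v, K s u * (∏ i, W i (t i) (v i)) * (e j u * star (e j v)) := by
        refine sum_congr rfl fun j _ => ?_
        rw [hW, Matrix.mulVec, dotProduct, sum_mul_sum]
        refine sum_congr rfl fun u _ => sum_congr rfl fun v _ => ?_
        ring
    _ = ∑ u, ∑ v, K s u * (∏ i, W i (t i) (v i)) * ∑ j, e j u * star (e j v) := by
        rw [sum_comm]
        refine sum_congr rfl fun u _ => ?_
        rw [sum_comm]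
        exact sum_congr rfl fun v _ => (mul_sum _ _ _).symm
    _ = ∑ u, K s u * (∏ i, W i (t i) (u i)) := by
        simp only [sum_mul_star_basis, mul_ite, mul_one, mul_zero, sum_ite_eq, mem_univ, if_true]

theorem partitionFunction_eq {H : Op n d} (hH : H.IsHermitian) (β : ℝ) :
    partitionFunction H β = frob (NormedSpace.exp ((-(β / 2 : ℂ)) • H)) ^ 2 := by
  set K := NormedSpace.exp ((-(β / 2 : ℂ)) • H) with hK
  have hherm : K.conjTranspose = K := by
    rw [hK, ← Matrix.exp_conjTranspose, Matrix.conjTranspose_smul, hH]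
    congr 2
    simp
  have hKK : K * K = NormedSpace.exp ((-(β : ℂ)) • H) := by
    rw [hK, ← Matrix.exp_add_of_commute _ _ (Commute.refl _), ← add_smul]
    congr 2
    ring
  have h := frob_sq_eq_trace K
  rw [hherm, hKK] at h
  rw [partitionFunction, h, Complex.ofReal_re]

end Purification

/-! ### Splitting the temperature and choosing the parameters -/

section Scaling

variable {n d k : ℕ} {g J η : ℝ} {h : Finset (Fin n) → Op n d}

theorem IsPowerLawInteraction.smul (hh : IsPowerLawInteraction k g J η h) {t : ℝ} (ht : 0 ≤ t) :
    IsPowerLawInteraction k (t * g) (t * J) η fun Z => (t : ℂ) • h Z := by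
  have hnorm : ∀ Z, opNorm ((t : ℂ) • h Z) = t * opNorm (h Z) := fun Z => by
    have : ‖(t : ℂ) • h Z‖ = t * ‖h Z‖ := by
      rw [norm_smul, Complex.norm_real, Real.norm_of_nonneg ht]
    exact this
  refine ⟨fun Z => ?_, fun Z => ?_, fun Z hZ => ?_, fun i => ?_, fun i j hij => ?_⟩
  · rw [Matrix.IsHermitian, Matrix.conjTranspose_smul, hh.isHermitian Z]
    simp
  · exact LongRangeGibbs.mem_suppAlg.1 ((suppAlg d Z).smul_mem (hh.mem_suppAlg Z) _)
  · rw [hh.local_terms Z hZ, smul_zero]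
  · simp only [hnorm, ← mul_sum]
    exact mul_le_mul_of_nonneg_left (hh.site_energy i) ht
  · simp only [hnorm, ← mul_sum]
    rw [mul_assoc]
    exact mul_le_mul_of_nonneg_left (hh.decay i j hij) ht

theorem IsPowerLawInteraction.isHermitian_hamiltonian (hh : IsPowerLawInteraction k g J η h) :
    (hamiltonian h).IsHermitian := by
  rw [hamiltonian, Matrix.IsHermitian, Matrix.conjTranspose_sum]
  exact sum_congr rfl fun Z _ => hh.isHermitian Z

theorem Q0_pos (hk : 1 ≤ k) (hg : 0 < g) (hJ : 0 < J) (hη : 2 < η) : 0 < Q0 k g J η := by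
  have h1 : 0 < η - 2 := by linarith
  have h2 : 0 < η - 1 := by linarith
  have h3 : (0 : ℝ) < k := by exact_mod_cast hk
  rw [Q0]
  refine inv_pos.2 (lt_min ?_ ?_) <;> positivity

theorem steps_pos (hk : 1 ≤ k) (hg : 0 < g) (hJ : 0 < J) (hη : 2 < η) {β : ℝ} (hβ : 0 < β) :
    0 < steps k g J η β := by
  have := Q0_pos hk hg hJ hη
  exact Nat.ceil_pos.2 (by positivity)

theorem kappa_eq (k d : ℕ) (g J η β : ℝ) :
    kappa k d g J η β = 4 * (rankExponent k d η + 4) * steps k g J η β := by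
  rw [kappa, rankExponent]
  ring

theorem kappa_pos (hk : 1 ≤ k) (hd : 1 ≤ d) (hg : 0 < g) (hJ : 0 < J) (hη : 2 < η) {β : ℝ}
    (hβ : 0 < β) : 0 < kappa k d g J η β := by
  have h1 : (0 : ℝ) < steps k g J η β := by exact_mod_cast steps_pos hk hg hJ hη hβ
  have h2 := two_le_rankExponent (k := k) hd hη
  rw [kappa_eq]
  have : 0 < rankExponent k d η + 4 := by linarith
  positivity

/-- From (1 + δ)^m ≤ e^y with y = mδ, and e^y ≤ 1/(1-y) ≤ 1 + 2y for y ≤ 1/2. -/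
theorem one_add_pow_sub_one_le {δ : ℝ} (hδ : 0 ≤ δ) {m : ℕ} (hm : m * δ ≤ 1 / 2) :
    (1 + δ) ^ m - 1 ≤ 2 * (m * δ) := by
  have h1 : (1 + δ) ^ m ≤ Real.exp (m * δ) := by
    rw [Real.exp_nat_mul]
    exact pow_le_pow_left₀ (by linarith) (by linarith [Real.add_one_le_exp δ]) m
  set y := m * δ with hy
  have hy0 : 0 ≤ y := by positivity
  have h2 : Real.exp y * (1 - y) ≤ 1 := by
    calc Real.exp y * (1 - y) ≤ Real.exp y * Real.exp (-y) := by
          gcongr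
          linarith [Real.add_one_le_exp (-y)]
      _ = 1 := by rw [← Real.exp_add]; simp
  nlinarith [Real.exp_pos y]

variable {e e' : OrthonormalBasis (Config n d) ℂ (ChainSpace n d)}

theorem frob_exp_pos [Nonempty (Config n d)] (A : Op n d) : 0 < frob (NormedSpace.exp A) := by
  refine (frob_nonneg _).lt_of_ne' fun h0 => ?_
  have h1 : NormedSpace.exp A * NormedSpace.exp (-A) = 1 := by
    rw [← Matrix.exp_add_of_commute _ _ (Commute.refl A).neg_right, add_neg_cancel,
      NormedSpace.exp_zero]
  have h2 := frob_mul_le' (NormedSpace.exp A) (NormedSpace.exp (-A))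
  rw [h1, h0, zero_mul] at h2
  have h3 := frob_sq (1 : Op n d)
  rw [le_antisymm h2 (frob_nonneg _)] at h3
  obtain ⟨s⟩ := ‹Nonempty (Config n d)›
  have h4 : (1 : ℝ) ≤ ∑ i, ∑ j, ‖(1 : Op n d) i j‖ ^ 2 := by
    refine le_trans ?_ (single_le_sum (f := fun i => ∑ j, ‖(1 : Op n d) i j‖ ^ 2)
      (fun i _ => sum_nonneg fun j _ => sq_nonneg _) (mem_univ s))
    refine le_trans ?_ (single_le_sum (f := fun j => ‖(1 : Op n d) s j‖ ^ 2)
      (fun j _ => sq_nonneg _) (mem_univ s))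
    simp
  rw [← h3] at h4
  norm_num at h4

/-- The unitaries preserve the norm and √Z_β is the norm of e^{-βH/2}, so the distance of the
vectors is a relative Hilbert-Schmidt error. -/
theorem norm_purifiedGibbs_sub [Nonempty (Config n d)] {H : Op n d} (hH : H.IsHermitian) (β : ℝ)
    {W : Fin n → Matrix (Fin d) (Fin d) ℂ} (hWu : ∀ i, (W i).conjTranspose * W i = 1)
    (hW : ∀ j t : Config n d, e' j t = ∑ s : Config n d, (∏ i, W i (t i) (s i)) * star (e j s))
    (Y : Op n d) :
    ‖purifiedGibbs H β e e' - (((Real.sqrt (partitionFunction H β) : ℝ) : ℂ)⁻¹) •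
      chainVec (Y * siteProd W)‖ =
        frob (Y - NormedSpace.exp ((-(β / 2 : ℂ)) • H)) /
          frob (NormedSpace.exp ((-(β / 2 : ℂ)) • H)) := by
  rw [purifiedGibbs_eq H β e e' hW, ← smul_sub, ← chainVec_sub, ← Matrix.sub_mul, norm_smul,
    norm_chainVec, frob_mul_unitary _ (siteProd_mul_conjTranspose hWu), partitionFunction_eq hH,
    Real.sqrt_sq (frob_nonneg _), norm_inv, Complex.norm_real, Real.norm_of_nonneg (frob_nonneg _),
    inv_mul_eq_div]
  congr 1
  rw [← neg_sub, ← neg_one_smul ℂ, frob_smul]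
  simp

theorem norm_purifiedGibbs [Nonempty (Config n d)] {H : Op n d} (hH : H.IsHermitian) (β : ℝ)
    {W : Fin n → Matrix (Fin d) (Fin d) ℂ} (hWu : ∀ i, (W i).conjTranspose * W i = 1)
    (hW : ∀ j t : Config n d, e' j t = ∑ s : Config n d, (∏ i, W i (t i) (s i)) * star (e j s)) :
    ‖purifiedGibbs H β e e'‖ = 1 := by
  have h := norm_purifiedGibbs_sub hH β hWu hW 0
  have h0 : chainVec (0 : Op n d) = 0 := rfl
  rw [Matrix.zero_mul, h0, smul_zero, sub_zero, zero_sub, ← neg_one_smul ℂ, frob_smul] at h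
  rw [h]
  simpa using div_self (frob_exp_pos _).ne'

theorem exists_mps_purifiedGibbs (hk : 1 ≤ k) (hd : 1 ≤ d) (hg : 0 < g) (hJ : 0 < J)
    (hη : 2 < η) (hn : 1 ≤ n) (hh : IsPowerLawInteraction k g J η h) (hcopy : IsLocalCopy e e')
    {β : ℝ} (hβ : 0 < β) {D : ℕ} (hD : 1 ≤ D) :
    ∃ M : Fin n → Fin d × Fin d → Matrix (Fin D) (Fin D) ℂ,
      ‖purifiedGibbs (hamiltonian h) β e e' - mps M‖ ≤
        960 * n * steps k g J η β * (D : ℝ) ^ (-1 / kappa k d g J η β) := by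
  have : Nonempty (Config n d) := ⟨fun _ => ⟨0, hd⟩⟩
  have : Nonempty (Fin d × Fin d) := ⟨(⟨0, hd⟩, ⟨0, hd⟩)⟩
  obtain ⟨W, hW⟩ := hcopy
  have hWu : ∀ i, (W i : Matrix (Fin d) (Fin d) ℂ).conjTranspose * (W i : Matrix _ _ ℂ) = 1 :=
    fun i => (Matrix.mem_unitaryGroup_iff').1 (W i).2
  have hH := hh.isHermitian_hamiltonian
  set q := steps k g J η β with hq
  set κ := kappa k d g J η β with hκ
  set γ := rankExponent k d η with hγ
  have hq0 : 0 < q := steps_pos hk hg hJ hη hβ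
  have hqr : (0 : ℝ) < q := by exact_mod_cast hq0
  have hq1 : (1 : ℝ) ≤ q := by exact_mod_cast hq0
  have hn1 : (1 : ℝ) ≤ n := by exact_mod_cast hn
  have hκ0 : 0 < κ := kappa_pos hk hd hg hJ hη hβ
  have hγ2 : 2 ≤ γ := two_le_rankExponent hd hη
  have hD1 : (1 : ℝ) ≤ D := by exact_mod_cast hD
  have hD0 : (0 : ℝ) < D := by linarith
  set x : ℝ := (D : ℝ) ^ (1 / κ) with hx
  have hx1 : 1 ≤ x := Real.one_le_rpow hD1 (by positivity)
  have hx0 : 0 < x := by linarith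
  have hxD : x ^ κ = D := by
    rw [hx, ← Real.rpow_mul hD0.le, one_div_mul_cancel hκ0.ne', Real.rpow_one]
  have hxinv : (D : ℝ) ^ (-1 / κ) = 1 / x := by
    rw [neg_div, Real.rpow_neg hD0.le, one_div x]
  rw [hxinv]
  -- In the first case the claimed bound is at least 1, the norm of the state, and the zero MPS
  -- suffices.
  rcases le_or_gt x (960 * n * q) with hsmall | hbig
  · refine ⟨fun _ _ => 0, ?_⟩
    have h0 : mps (fun (_ : Fin n) (_ : Fin d × Fin d) => (0 : Matrix (Fin D) (Fin D) ℂ)) = 0 := by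
      obtain ⟨n, rfl⟩ : ∃ m, n = m + 1 := ⟨n - 1, by omega⟩
      ext σ
      simp [mps, List.ofFn_succ]
    rw [h0, sub_zero, norm_purifiedGibbs hH β hWu hW, mul_one_div, le_div_iff₀ hx0, one_mul]
    exact hsmall
  -- the scaled Hamiltonian
  have hQ := Q0_pos hk hg hJ hη
  -- The state involves β/2 = 2q t; the choice of q makes t ≤ 1/𝒬₀, the high-temperature regime.
  set t : ℝ := β / (4 * q) with ht
  have ht0 : 0 ≤ t := by positivity
  have htQ : t ≤ (Q0 k g J η)⁻¹ := by
    have h1 : β * Q0 k g J η / 4 ≤ q := Nat.le_ceil _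
    rw [ht, inv_eq_one_div, div_le_div_iff₀ (by positivity) hQ]
    linarith
  rw [Q0, inv_inv] at htQ
  have hkr : (0 : ℝ) < k := by exact_mod_cast hk
  have hη1 : 0 < η - 1 := by linarith
  have hgk : 8 * (t * g) * k ≤ 1 := by
    have h1 := htQ.trans (min_le_left _ _)
    rw [le_div_iff₀ (by positivity)] at h1
    linarith
  have htJ : t * J * (16 * Real.exp 1 * (η - 1) ^ 2 * (2 : ℝ) ^ (η - 2)) ≤ η - 2 := by
    have h1 := htQ.trans (min_le_right _ _)
    rw [le_div_iff₀ (by positivity)] at h1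
    linarith
  have hh' := hh.smul ht0
  have hham : hamiltonian (fun Z => (t : ℂ) • h Z) = (t : ℂ) • hamiltonian h := by
    rw [hamiltonian, hamiltonian, smul_sum]
  set X : Op n d := NormedSpace.exp (-hamiltonian fun Z => (t : ℂ) • h Z) with hX
  have hXh : X.IsHermitian := (hh'.isHermitian_hamiltonian.neg).exp
  have hXpow : X ^ (2 * q) = NormedSpace.exp ((-(β / 2 : ℂ)) • hamiltonian h) := by
    rw [hX, ← Matrix.exp_nsmul, hham, ← neg_smul, ← Nat.cast_smul_eq_nsmul ℂ, smul_smul]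
    congr 2
    rw [ht]
    push_cast
    have : (q : ℂ) ≠ 0 := by exact_mod_cast hq0.ne'
    field_simp
    ring
  -- the order of the expansion
  set w : ℕ := ⌊Real.logb 2 x⌋₊ with hw
  have hlog0 : 0 ≤ Real.logb 2 x := Real.logb_nonneg (by norm_num) hx1
  have hw1 : (2 : ℝ) ^ w ≤ x := by
    rw [← Real.rpow_natCast, ← Real.le_logb_iff_rpow_le (by norm_num) hx0]
    exact Nat.floor_le hlog0
  have hw2 : x ≤ (2 : ℝ) ^ (w + 1) := by
    rw [← Real.rpow_natCast, ← Real.logb_le_iff_le_rpow (by norm_num) hx0]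
    push_cast
    exact (Nat.lt_floor_add_one _).le
  set δ : ℝ := 6 * (1 / 2) ^ w with hδ
  have hδ0 : 0 ≤ δ := by positivity
  have hδx : δ ≤ 12 / x := by
    rw [le_div_iff₀ hx0]
    calc δ * x ≤ δ * 2 ^ (w + 1) := by gcongr
      _ = 12 * ((1 / 2) ^ w * 2 ^ w) := by rw [hδ, pow_succ]; ring
      _ = 12 := by rw [← mul_pow]; norm_num
  have hrank : ((w : ℝ) + 1) * ((2 : ℝ) ^ γ) ^ w ≤ x ^ (γ + 1) := by
    rw [Real.rpow_add hx0, Real.rpow_one, mul_comm]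
    refine mul_le_mul ?_ ?_ (by positivity) (by positivity)
    · rw [← Real.rpow_natCast, ← Real.rpow_mul (by norm_num), mul_comm, Real.rpow_mul (by norm_num),
        Real.rpow_natCast]
      exact Real.rpow_le_rpow (by positivity) hw1 (by linarith)
    · refine le_trans ?_ hw1
      exact_mod_cast Nat.lt_two_pow_self
  -- Here D = x^κ and 2q(γ+1) ≤ 4q(γ+4) = κ.
  have hrankD : (x ^ (γ + 1)) ^ (2 * q) ≤ D := by
    rw [← hxD, ← Real.rpow_natCast, ← Real.rpow_mul hx0.le]
    refine Real.rpow_le_rpow_of_exponent_le hx1 ?_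
    rw [hκ, kappa_eq]
    push_cast
    nlinarith
  have herr : (1 + δ) ^ (2 * q) - 1 ≤ 960 * q * (1 / x) := by
    have h1 : ((2 * q : ℕ) : ℝ) * δ ≤ 24 * q * (1 / x) := by
      push_cast
      calc 2 * (q : ℝ) * δ ≤ 2 * q * (12 / x) := by gcongr
        _ = _ := by ring
    -- This is where x > 960 n q enters.
    have h2 : 24 * (q : ℝ) * (1 / x) ≤ 1 / 2 := by
      rw [mul_one_div, div_le_iff₀ hx0]
      nlinarith
    have h3 : 0 ≤ (q : ℝ) * (1 / x) := by positivity
    have := one_add_pow_sub_one_le hδ0 (h1.trans h2)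
    linarith
  obtain ⟨M, hM⟩ := exists_mps_norm_sub_le hn hD (purifiedGibbs (hamiltonian h) β e e')
    (960 * q * (1 / x)) fun c => by
      obtain ⟨E, hE, hS⟩ := exists_schmidtLE_one_add_mul_exp hn hk hd hη hh'
        (mul_nonneg ht0 hg.le) (mul_nonneg ht0 hJ.le) hgk htJ c w
      have hcomm := suppAlg_commute (d := d) (disjoint_compl_right (a := leftSites n c))
      have hS2 := (((hS.mono hrank).pow hcomm (2 * q)).mul hcomm
        (schmidtLE_siteProd (leftSites n c) fun i => (W i : Matrix (Fin d) (Fin d) ℂ))).smul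
          (((Real.sqrt (partitionFunction (hamiltonian h) β) : ℝ) : ℂ)⁻¹)
      rw [mul_one] at hS2
      refine ⟨_, hS2.cutRank hrankD, ?_⟩
      have h1 := norm_purifiedGibbs_sub (e := e) (e' := e') hH β hWu hW (((1 + E) * X) ^ (2 * q))
      refine le_trans (le_of_eq h1) ?_
      rw [← hXpow, div_le_iff₀ (hXpow ▸ frob_exp_pos _)]
      refine (frob_pow_sub_pow_le hXh hE (2 * q)).trans ?_
      exact mul_le_mul_of_nonneg_right herr (frob_nonneg _)
  exact ⟨M, hM.trans (le_of_eq (by ring))⟩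

/-- Take D = ⌈y^κ⌉ with y = 960 n q / ε. Both q and κ are O(1 + β), and y is at most a fixed power
of B = (2 + β) n / ε. As B ≥ 2, one more factor B absorbs the rounding, which is the leading 1 in C.
-/
theorem exists_bondDimension_le (hk : 1 ≤ k) (hd : 1 ≤ d) (hg : 0 < g) (hJ : 0 < J)
    (hη : 2 < η) : ∃ C : ℝ, 0 < C ∧ ∀ n : ℕ, 1 ≤ n → ∀ β : ℝ, 0 < β → ∀ ε : ℝ, 0 < ε → ε ≤ 1 →
      ∃ D : ℕ, 1 ≤ D ∧ (D : ℝ) ≤ ((2 + β) * n / ε) ^ (C * (1 + β)) ∧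
        960 * n * steps k g J η β * (D : ℝ) ^ (-1 / kappa k d g J η β) ≤ ε := by
  have hQ := Q0_pos hk hg hJ hη
  set Q := Q0 k g J η with hQdef
  have hγ2 : 2 ≤ rankExponent k d η := two_le_rankExponent hd hη
  set a : ℝ := 4 * (rankExponent k d η + 4) with ha
  have ha0 : 0 < a := by linarith
  set c : ℝ := Real.logb 2 (960 * (1 + Q)) with hc
  have hc0 : 0 ≤ c := Real.logb_nonneg (by norm_num) (by linarith)
  refine ⟨1 + (c + 1) * (a * (1 + Q)), by positivity, fun n hn β hβ ε hε hε1 => ?_⟩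
  have hn1 : (1 : ℝ) ≤ n := by exact_mod_cast hn
  set B : ℝ := (2 + β) * n / ε with hB
  have hB2 : 2 ≤ B := by
    rw [hB, le_div_iff₀ hε]
    nlinarith
  have hB0 : 0 < B := by linarith
  have hq0 := steps_pos hk hg hJ hη hβ
  have hκ0 : 0 < kappa k d g J η β := kappa_pos hk hd hg hJ hη hβ
  set κ := kappa k d g J η β with hκ
  set q := steps k g J η β with hq
  have hq1 : (1 : ℝ) ≤ q := by exact_mod_cast hq0
  have hqle : (q : ℝ) ≤ (1 + Q) * (1 + β) := by
    have h1 : (q : ℝ) < β * Q / 4 + 1 := Nat.ceil_lt_add_one (by positivity)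
    nlinarith [mul_pos hβ hQ]
  have hκle : κ ≤ a * (1 + Q) * (1 + β) := by
    rw [hκ, kappa_eq, mul_assoc a]
    exact mul_le_mul_of_nonneg_left hqle ha0.le
  set y : ℝ := 960 * n * q / ε with hy
  have hy1 : 1 ≤ y := by
    rw [hy, le_div_iff₀ hε]
    nlinarith
  have hyB : y ≤ B ^ (c + 1) := by
    have h1 : 960 * (1 + Q) ≤ B ^ c := by
      calc 960 * (1 + Q) = (2 : ℝ) ^ c := by
            rw [hc, Real.rpow_logb (by norm_num) (by norm_num) (by positivity)]
        _ ≤ B ^ c := Real.rpow_le_rpow (by norm_num) hB2 hc0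
    rw [Real.rpow_add hB0, Real.rpow_one]
    calc y ≤ 960 * n * ((1 + Q) * (2 + β)) / ε := by
          rw [hy]
          gcongr
          exact hqle.trans (by gcongr; norm_num)
      _ = 960 * (1 + Q) * B := by rw [hB]; ring
      _ ≤ B ^ c * B := by gcongr
  have hyκ : 1 ≤ y ^ κ := Real.one_le_rpow hy1 hκ0.le
  have hyD : y ^ κ ≤ (⌈y ^ κ⌉₊ : ℝ) := Nat.le_ceil _
  refine ⟨⌈y ^ κ⌉₊, Nat.ceil_pos.2 (by linarith), ?_, ?_⟩
  · calc (⌈y ^ κ⌉₊ : ℝ) ≤ 2 * y ^ κ := by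
          have := Nat.ceil_lt_add_one (a := y ^ κ) (by linarith)
          linarith
      _ ≤ B * (B ^ (c + 1)) ^ κ := by
          gcongr
      _ = B ^ (1 + (c + 1) * κ) := by
          rw [Real.rpow_add hB0 1, Real.rpow_one, Real.rpow_mul hB0.le]
      _ ≤ _ := by
          refine Real.rpow_le_rpow_of_exponent_le (by linarith) ?_
          have : (c + 1) * κ ≤ (c + 1) * (a * (1 + Q) * (1 + β)) := by gcongr
          nlinarith
  · have hD0 : (0 : ℝ) < (⌈y ^ κ⌉₊ : ℝ) := by linarith
    have h1 : (⌈y ^ κ⌉₊ : ℝ) ^ (-1 / κ) ≤ 1 / y := by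
      calc _ ≤ (y ^ κ) ^ (-1 / κ) :=
            Real.rpow_le_rpow_of_nonpos (by linarith) hyD
              (div_nonpos_of_nonpos_of_nonneg (by norm_num) hκ0.le)
        _ = 1 / y := by
            rw [← Real.rpow_mul (by linarith), mul_div_cancel₀ _ hκ0.ne', Real.rpow_neg_one,
              one_div]
    calc _ ≤ 960 * n * q * (1 / y) := by gcongr
      _ = ε := by
          rw [hy]
          field_simp

end Scaling
end LongRangeGibbs

end

theorem mainTheorem10 (k d : ℕ) (hk : 1 ≤ k) (hd : 1 ≤ d)
    (g J₀ η : ℝ) (hg : 0 < g) (hJ₀ : 0 < J₀) (hη : 2 < η) :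
    (∀ (n : ℕ), 1 ≤ n →
      ∀ h : Finset (Fin n) → LongRangeGibbs.Op n d,
      LongRangeGibbs.IsPowerLawInteraction k g J₀ η h →
      ∀ e e' : OrthonormalBasis (LongRangeGibbs.Config n d) ℂ (LongRangeGibbs.ChainSpace n d),
      LongRangeGibbs.IsLocalCopy e e' →
      ∀ β : ℝ, 0 < β → ∀ D : ℕ, 1 ≤ D →
        ∃ M : Fin n → Fin d × Fin d → Matrix (Fin D) (Fin D) ℂ,
          ‖LongRangeGibbs.purifiedGibbs (LongRangeGibbs.hamiltonian h) β e e'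
              - LongRangeGibbs.mps M‖
            ≤ 960 * n * LongRangeGibbs.steps k g J₀ η β
                * (D : ℝ) ^ (-1 / LongRangeGibbs.kappa k d g J₀ η β)) ∧
    (∃ C : ℝ, 0 < C ∧
      ∀ (n : ℕ), 1 ≤ n →
      ∀ h : Finset (Fin n) → LongRangeGibbs.Op n d,
      LongRangeGibbs.IsPowerLawInteraction k g J₀ η h →
      ∀ e e' : OrthonormalBasis (LongRangeGibbs.Config n d) ℂ (LongRangeGibbs.ChainSpace n d),
      LongRangeGibbs.IsLocalCopy e e' →
      ∀ β : ℝ, 0 < β → ∀ ε : ℝ, 0 < ε → ε ≤ 1 →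
        ∃ D : ℕ, 1 ≤ D ∧ (D : ℝ) ≤ ((2 + β) * n / ε) ^ (C * (1 + β)) ∧
          ∃ M : Fin n → Fin d × Fin d → Matrix (Fin D) (Fin D) ℂ,
            ‖LongRangeGibbs.purifiedGibbs (LongRangeGibbs.hamiltonian h) β e e'
                - LongRangeGibbs.mps M‖ ≤ ε) :=
  ⟨fun _ hn _ hh _ _ hcopy _ hβ _ hD =>
      LongRangeGibbs.exists_mps_purifiedGibbs hk hd hg hJ₀ hη hn hh hcopy hβ hD, by
    obtain ⟨C, hC, hbound⟩ := LongRangeGibbs.exists_bondDimension_le hk hd hg hJ₀ hη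
    refine ⟨C, hC, fun n hn h hh e e' hcopy β hβ ε hε hε1 => ?_⟩
    obtain ⟨D, hD, hDle, hDε⟩ := hbound n hn β hβ ε hε hε1
    obtain ⟨M, hM⟩ :=
      LongRangeGibbs.exists_mps_purifiedGibbs hk hd hg hJ₀ hη hn hh hcopy hβ hD
    exact ⟨D, hD, hDle, M, hM.trans hDε⟩⟩
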